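/- Let $t\ge 2$ and $h\ge 0$ be integers, let $\mathcal V_1,\dots,\mathcal V_t\subseteq\{1,\dots,h\}$ be arbitrary, and write $\mathcal V=(\mathcal V_i)_{i=1}^t$. Let $\mathcal X$ be a finite alphabet, let $X$ be a random variable on $\mathcal X$ with entropy $H(X)$ (in bits), and let $q$ be the joint probability mass function of $(X_1,\dots,X_t)$ with $X_1=\dots=X_t=X$. For $n\ge 0$ let $q^{(n)}$ be the law of $n$ i.i.d. copies of $(X_1,\dots,X_t)$, i.e. $q^{(n)}(x_1^n,\dots,x_t^n)=\prod_{s=1}^n q(x_{1,s},\dots,x_{t,s})$. For a non-negative rate tuple $(R,R_1,\dots,R_h)$, an $(n,2^{nR},2^{nR_1},\dots,2^{nR_h})$ simulation code (omniscient coordinator) consists of conditional probability mass functions $p(m\mid w_1,\dots,w_h)$ and $p(x_i^n\mid m,(w_j)_{j\in\mathcal V_i})$ for $i=1,\dots,t$, where $m\in\{1,\dots,\lfloor 2^{nR}\rfloor\}$, $w_j\in\{1,\dots,\lfloor 2^{nR_j}\rfloor\}$ and $x_i^n\in\mathcal X^n$. It induces on the outputs the probability mass function $$p^{\mathrm{ind}}(x_1^n,\dots,x_t^n)=\sum_{w_1,\dots,w_h,m}\frac{p(m\mid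 w_1,\dots,w_h)\prod_{i=1}^t p(x_i^n\mid m,(w_j)_{j\in\mathcal V_i})}{\prod_{j=1}^h\lfloor 2^{nR_j}\rfloor},$$ i.e. the sources $w_j$ are independent and uniform. The tuple $(R,R_1,\dots,R_h)$ is achievable if there is a sequence of such codes, one for each $n$, with $\lim_{n\to\infty}\lVert p^{\mathrm{ind}}-q^{(n)}\rVert_1=0$. The simulation rate region $\mathcal R(\mathcal V)\subseteq\mathbb R^{1+h}$ is the closure of the set of achievable rate tuples. **Theorem.** $\mathcal R(\mathcal V)$ is the set of all non-negative tuples $(R,R_1,\dots,R_h)$ for which there exist non-negative reals $r,r_1,\dots,r_h$ such that $$R\ \ge\ \Big(\sum_{j\notin\mathcal V_i} r_j\Big)+r\quad(i=1,\dots,t),\qquad H(X)\ \le\ r+\sum_{j=1}^h r_j,\qquad R_j\ \ge\ r_j\quad(j=1,\dots,h).$$ -/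

import Mathlib

open Filter Topology

namespace Omniscient

/-- The size of the index set `[1 : 2^{nR}]`, i.e. the number of integers in `[1, 2^{nR}]`. -/
noncomputable def indexSize (n : ℕ) (R : ℝ) : ℕ := ⌊(2 : ℝ) ^ ((n : ℝ) * R)⌋₊

/-- Shannon entropy, in bits, of a probability mass function on a finite alphabet. -/
noncomputable def entropy {α : Type*} [Fintype α] (p : PMF α) : ℝ :=
  ∑ a, Real.negMulLog (p a).toReal / Real.log 2

/-- A simulation code of block length `n` for `t` processors, `h` sources of shared randomness,
access sets `V i` and output alphabets `𝒳 i`. There are `N` messages, and source `j` takes `K j`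
values. The coordinator sees all sources and picks a message at random. Processor `i` sees the
message and the sources in `V i`, and picks a word in `(𝒳 i)^n` at random. -/
structure SimulationCode {t h : ℕ} (V : Fin t → Finset (Fin h)) (𝒳 : Fin t → Type*)
    (n N : ℕ) (K : Fin h → ℕ) where
  coordinator : (∀ j, Fin (K j)) → PMF (Fin N)
  processor : ∀ i, Fin N → (∀ j : V i, Fin (K j)) → PMF (Fin n → 𝒳 i)

namespace SimulationCode

variable {t h : ℕ} {V : Fin t → Finset (Fin h)} {𝒳 : Fin t → Type*} {n N : ℕ} {K : Fin h → ℕ}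

/-- The joint mass function of the (independent, uniform) sources, the message and the outputs. -/
noncomputable def joint (c : SimulationCode V 𝒳 n N K)
    (w : ∀ j, Fin (K j)) (m : Fin N) (x : ∀ i, Fin n → 𝒳 i) : ℝ :=
  ((c.coordinator w m).toReal * ∏ i, (c.processor i m (fun j => w j) (x i)).toReal) /
    ∏ j, (K j : ℝ)

/-- The induced mass function of the outputs. -/
noncomputable def induced (c : SimulationCode V 𝒳 n N K) (x : ∀ i, Fin n → 𝒳 i) : ℝ :=
  ∑ w : (∀ j, Fin (K j)), ∑ m : Fin N, c.joint w m x

end SimulationCode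

/-- The `n`-fold i.i.d. mass function `q^{(n)}`. -/
noncomputable def iid {t : ℕ} {𝒳 : Fin t → Type*} (q : PMF (∀ i, 𝒳 i)) (n : ℕ)
    (x : ∀ i, Fin n → 𝒳 i) : ℝ :=
  ∏ s : Fin n, (q (fun i => x i s)).toReal

/-- The rate tuple `(R, R_1, …, R_h)`, written `ρ = (R, (R_j)_j)`, is achievable for `q`. -/
def Achievable {t h : ℕ} (V : Fin t → Finset (Fin h)) {𝒳 : Fin t → Type*} [∀ i, Fintype (𝒳 i)]
    (q : PMF (∀ i, 𝒳 i)) (ρ : ℝ × (Fin h → ℝ)) : Prop :=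
  0 ≤ ρ.1 ∧ (∀ j, 0 ≤ ρ.2 j) ∧
    ∃ c : ∀ n : ℕ, SimulationCode V 𝒳 n (indexSize n ρ.1) (fun j => indexSize n (ρ.2 j)),
      Tendsto (fun n => ∑ x : (∀ i, Fin n → 𝒳 i), |(c n).induced x - iid q n x|) atTop (𝓝 0)

/-- The simulation rate region: the closure of the set of achievable rate tuples. -/
def rateRegion {t h : ℕ} (V : Fin t → Finset (Fin h)) {𝒳 : Fin t → Type*} [∀ i, Fintype (𝒳 i)]
    (q : PMF (∀ i, 𝒳 i)) : Set (ℝ × (Fin h → ℝ)) :=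
  closure {ρ | Achievable V q ρ}

end Omniscient

/-! Converse. Let `X` be the output word of one processor and `W_S` the sources in `S`. Given the
message and all sources the outputs are independent, so two outputs can nearly always agree only if
each is nearly a function of its own inputs (`exists_guess`). Hence `H(X | W_{V i})` is at most
about the logarithm of the number of messages (`entropyOf_output_le`). Since the sources are
independent, `f S = H(X | W_S)` drops by `I(X; W_j | W_S)` when `j` joins `S`, and this drop grows
with `S`. Add the sources one at a time, let `r_j` be the drop caused by `j` and `r` what is left at
the end (`exists_increments`). These sum to `H(X)`, each `r_j` is at most the entropy of its source,
and the growth of the drops gives `∑_{j ∉ V i} r_j + r ≤ H(X | W_{V i})`. Continuity of entropy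
(`sum_negMulLog_le`) replaces `H(X)` by `n` times the single-letter entropy; division by `n` gives
the rates.

Achievability. The coordinator draws a private value out of slightly more than `2^{nr}` and joins it
to residues of the sources, about `2^{n r_j}` of them for source `j`. The atoms of the resulting
tuple are exponentially smaller than `2^{-nH}`, so some function of the tuple is close in law to the
i.i.d. word (`exists_map_approx`, `tendsto_sum_min_prod`). The message is a colour of the tuple:
tuples that some processor cannot separate by its sources get different colours, and greedy
colouring (`exists_coloring`) needs about `max_i 2^{n(r + ∑_{j ∉ V i} r_j)}` of them. Every
processor then decodes the tuple without error.

Both inclusions cost an arbitrarily small slack in the message rate, which closedness of the two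
regions removes. -/

namespace Omniscient

/-! ### Entropy of functions on a finite sample space -/

section FiniteEntropy

variable {Ω α β γ : Type*} [Fintype Ω]

open Classical in
/-- The probability, under the mass function `P`, of the event that `φ` takes the value `φ ω`. -/
noncomputable def classMass (P : Ω → ℝ) (φ : Ω → β) (ω : Ω) : ℝ :=
  ∑ ω', if φ ω' = φ ω then P ω' else 0

/-- The entropy, in nats, of the random variable `φ` under the mass function `P`. -/
noncomputable def entropyOf (P : Ω → ℝ) (φ : Ω → β) : ℝ :=
  ∑ ω, P ω * -Real.log (classMass P φ ω)

lemma classMass_congr (P : Ω → ℝ) {φ : Ω → β} {ψ : Ω → γ}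
    (h : ∀ ω ω', φ ω' = φ ω ↔ ψ ω' = ψ ω) : classMass P φ = classMass P ψ := by
  classical
  funext ω
  simp only [classMass]
  refine Finset.sum_congr rfl fun ω' _ => ?_
  exact if_congr (h ω ω') rfl rfl

/-- Entropy depends only on the partition into fibres. This is how tuples of sources get reordered,
merged or enlarged below. -/
lemma entropyOf_congr (P : Ω → ℝ) {φ : Ω → β} {ψ : Ω → γ}
    (h : ∀ ω ω', φ ω' = φ ω ↔ ψ ω' = ψ ω) : entropyOf P φ = entropyOf P ψ := by
  simp only [entropyOf, classMass_congr P h]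

variable {P : Ω → ℝ}

lemma le_classMass (hP : ∀ ω, 0 ≤ P ω) (φ : Ω → β) (ω : Ω) : P ω ≤ classMass P φ ω := by
  classical
  have := Finset.single_le_sum (f := fun ω' => if φ ω' = φ ω then P ω' else 0)
    (fun ω' _ => by split_ifs <;> simp [hP]) (Finset.mem_univ ω)
  simpa [classMass] using this

lemma classMass_mono (hP : ∀ ω, 0 ≤ P ω) {φ : Ω → β} {ψ : Ω → γ}
    (h : ∀ ω ω', φ ω' = φ ω → ψ ω' = ψ ω) (ω : Ω) : classMass P φ ω ≤ classMass P ψ ω := by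
  classical
  refine Finset.sum_le_sum fun ω' _ => ?_
  by_cases h1 : φ ω' = φ ω
  · simp [h1, h ω ω' h1]
  · simp only [h1, if_false]
    split_ifs <;> simp [hP]

lemma entropyOf_mono (hP : ∀ ω, 0 ≤ P ω) {φ : Ω → β} {ψ : Ω → γ}
    (h : ∀ ω ω', φ ω' = φ ω → ψ ω' = ψ ω) : entropyOf P ψ ≤ entropyOf P φ := by
  refine Finset.sum_le_sum fun ω _ => ?_
  rcases (hP ω).eq_or_lt with h0 | h0
  · simp [← h0]
  · refine mul_le_mul_of_nonneg_left (neg_le_neg ?_) (hP ω)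
    exact Real.log_le_log (h0.trans_le (le_classMass hP φ ω)) (classMass_mono hP h ω)

-- The denominator is constant on the fibre and equals its mass. Only an inequality holds in
-- general, because an empty or null fibre contributes `0`.
open Classical in
lemma sum_div_classMass_le_one (θ : Ω → β) (v : β) :
    ∑ ω, (if θ ω = v then P ω / classMass P θ ω else 0) ≤ 1 := by
  by_cases hv : ∃ ω, θ ω = v
  · obtain ⟨ω₀, rfl⟩ := hv
    have : ∑ ω, (if θ ω = θ ω₀ then P ω / classMass P θ ω else 0)
        = classMass P θ ω₀ / classMass P θ ω₀ := by
      conv_rhs => rw [classMass, Finset.sum_div]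
      refine Finset.sum_congr rfl fun ω _ => ?_
      split_ifs with h
      · simp only [classMass, h]
      · simp
    rw [this]
    exact div_self_le_one _
  · push Not at hv
    simp [hv]

/-- Gibbs' inequality for conditional entropies: the conditional entropy of `ξ` given `φ` is at
most the cross entropy relative to any family of (sub-)distributions `Q (φ ω)`. -/
lemma entropyOf_prod_sub_le [Fintype α] (hP : ∀ ω, 0 ≤ P ω) (φ : Ω → β) (ξ : Ω → α)
    (Q : β → α → ℝ) (hQ : ∀ b a, 0 ≤ Q b a) (hQ1 : ∀ b, ∑ a, Q b a ≤ 1)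
    (hQP : ∀ ω, 0 < P ω → 0 < Q (φ ω) (ξ ω)) :
    entropyOf P (fun ω => (φ ω, ξ ω)) - entropyOf P φ ≤
      ∑ ω, P ω * -Real.log (Q (φ ω) (ξ ω)) := by
  classical
  set θ : Ω → β × α := fun ω => (φ ω, ξ ω) with hθ
  -- `log x ≤ x - 1`, where `x` is the ratio of `Q` to the true conditional probability. Summed over
  -- `ω`, the right-hand side is at most `0`.
  have hterm : ∀ ω, P ω * -Real.log (classMass P θ ω) - P ω * -Real.log (classMass P φ ω)
      - P ω * -Real.log (Q (φ ω) (ξ ω)) ≤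
      classMass P φ ω * (Q (φ ω) (ξ ω) * (P ω / classMass P θ ω)) - P ω := by
    intro ω
    rcases (hP ω).eq_or_lt with h0 | h0
    · simp [← h0]
    · have h1 := h0.trans_le (le_classMass hP θ ω)
      have h2 := h0.trans_le (le_classMass hP φ ω)
      have h3 := hQP ω h0
      have h4 := Real.log_le_sub_one_of_pos
        (x := classMass P φ ω * Q (φ ω) (ξ ω) / classMass P θ ω) (by positivity)
      rw [Real.log_div (by positivity) h1.ne', Real.log_mul h2.ne' h3.ne'] at h4
      calc _ = P ω * (Real.log (classMass P φ ω) + Real.log (Q (φ ω) (ξ ω))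
              - Real.log (classMass P θ ω)) := by ring
        _ ≤ P ω * (classMass P φ ω * Q (φ ω) (ξ ω) / classMass P θ ω - 1) :=
            mul_le_mul_of_nonneg_left h4 (hP ω)
        _ = _ := by ring
  have hinner : ∀ ω₁, ∑ ω, (if φ ω₁ = φ ω then Q (φ ω) (ξ ω) * (P ω / classMass P θ ω) else 0)
      ≤ 1 := by
    intro ω₁
    rw [← Finset.sum_fiberwise (g := ξ)]
    refine le_trans (Finset.sum_le_sum fun a _ => ?_) (hQ1 (φ ω₁))
    calc _ = ∑ ω, Q (φ ω₁) a * (if θ ω = (φ ω₁, a) then P ω / classMass P θ ω else 0) := by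
          rw [Finset.sum_filter]
          refine Finset.sum_congr rfl fun ω _ => ?_
          simp only [hθ, Prod.mk.injEq]
          by_cases h1 : ξ ω = a
          · by_cases h2 : φ ω = φ ω₁
            · simp [h1, h2]
            · simp [h1, h2, Ne.symm h2]
          · simp [h1]
      _ ≤ Q (φ ω₁) a := by
          rw [← Finset.mul_sum]
          refine mul_le_of_le_one_right (hQ _ _) ?_
          refine le_trans (le_of_eq ?_) (sum_div_classMass_le_one (P := P) θ (φ ω₁, a))
          congr!
  have hsum : ∑ ω, classMass P φ ω * (Q (φ ω) (ξ ω) * (P ω / classMass P θ ω)) ≤ ∑ ω, P ω := by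
    have hexp : ∀ ω, classMass P φ ω = ∑ ω', if φ ω' = φ ω then P ω' else 0 := fun ω => by
      unfold classMass
      congr!
    simp only [hexp, Finset.sum_mul]
    rw [Finset.sum_comm]
    refine Finset.sum_le_sum fun ω₁ _ => ?_
    calc _ = P ω₁ * ∑ ω, (if φ ω₁ = φ ω then Q (φ ω) (ξ ω) * (P ω / classMass P θ ω) else 0) := by
          rw [Finset.mul_sum]
          refine Finset.sum_congr rfl fun ω _ => ?_
          split_ifs <;> simp
      _ ≤ P ω₁ := mul_le_of_le_one_right (hP _) (hinner ω₁)
  have := Finset.sum_le_sum fun ω (_ : ω ∈ Finset.univ) => hterm ω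
  simp only [Finset.sum_sub_distrib] at this
  simp only [entropyOf]
  linarith

/-- Gibbs' inequality against the uniform distribution. -/
lemma entropyOf_prod_le_log_card [Fintype α] (hP : ∀ ω, 0 ≤ P ω) (hP1 : ∑ ω, P ω = 1)
    (φ : Ω → β) (ξ : Ω → α) :
    entropyOf P (fun ω => (φ ω, ξ ω)) - entropyOf P φ ≤ Real.log (Fintype.card α) := by
  rcases isEmpty_or_nonempty α with hα | hα
  · have : IsEmpty Ω := ⟨fun ω => hα.elim (ξ ω)⟩
    simp at hP1
  have hpos : (0 : ℝ) < Fintype.card α := by exact_mod_cast Fintype.card_pos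
  refine (entropyOf_prod_sub_le hP φ ξ (fun _ _ => (Fintype.card α : ℝ)⁻¹)
    (fun _ _ => by positivity) (fun _ => ?_) (fun _ _ => by positivity)).trans ?_
  · simp [hpos.ne']
  · simp [← Finset.sum_mul, hP1]

/-- Submodularity of entropy. -/
lemma entropyOf_submodular [Fintype α] (hP : ∀ ω, 0 ≤ P ω)
    (φ : Ω → β) (ψ : Ω → γ) (ξ : Ω → α) :
    entropyOf P (fun ω => ((φ ω, ψ ω), ξ ω)) - entropyOf P (fun ω => (φ ω, ψ ω)) ≤
      entropyOf P (fun ω => (φ ω, ξ ω)) - entropyOf P φ := by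
  classical
  set p₁ : β → ℝ := fun b => ∑ ω, if φ ω = b then P ω else 0 with hp₁
  set p₂ : β → α → ℝ := fun b a => ∑ ω, if (φ ω, ξ ω) = (b, a) then P ω else 0 with hp₂
  have h₁ : ∀ b, 0 ≤ p₁ b := fun b => Finset.sum_nonneg fun ω _ => by split_ifs <;> simp [hP]
  have h₂ : ∀ b a, 0 ≤ p₂ b a :=
    fun b a => Finset.sum_nonneg fun ω _ => by split_ifs <;> simp [hP]
  have hc₁ : ∀ ω, classMass P φ ω = p₁ (φ ω) := fun ω => rfl
  have hc₂ : ∀ ω, classMass P (fun ω => (φ ω, ξ ω)) ω = p₂ (φ ω) (ξ ω) := fun ω => by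
    simp only [hp₂]
    unfold classMass
    congr!
  have hs : ∀ b, ∑ a, p₂ b a = p₁ b := by
    intro b
    simp only [hp₂, hp₁]
    rw [Finset.sum_comm]
    refine Finset.sum_congr rfl fun ω _ => ?_
    by_cases h : φ ω = b <;> simp [h]
  -- The competitor in Gibbs' inequality is the true conditional law of `ξ` given `φ` alone, which
  -- ignores `ψ`.
  refine (entropyOf_prod_sub_le hP (fun ω => (φ ω, ψ ω)) ξ (fun b a => p₂ b.1 a / p₁ b.1)
    (fun b a => div_nonneg (h₂ _ _) (h₁ _)) (fun b => ?_) (fun ω h0 => ?_)).trans (le_of_eq ?_)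
  · rw [← Finset.sum_div, hs]
    exact div_self_le_one _
  · exact div_pos (hc₂ ω ▸ h0.trans_le (le_classMass hP _ ω))
      (hc₁ ω ▸ h0.trans_le (le_classMass hP _ ω))
  · simp only [entropyOf, ← Finset.sum_sub_distrib]
    refine Finset.sum_congr rfl fun ω _ => ?_
    rcases (hP ω).eq_or_lt with h0 | h0
    · simp [← h0]
    · have a1 := h0.trans_le (le_classMass hP φ ω)
      have a2 := h0.trans_le (le_classMass hP (fun ω => (φ ω, ξ ω)) ω)
      rw [hc₁] at a1 ⊢
      rw [hc₂] at a2 ⊢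
      rw [Real.log_div a2.ne' a1.ne']
      ring

open Classical in
lemma entropyOf_eq_sum_negMulLog [Fintype α] (ξ : Ω → α) :
    entropyOf P ξ = ∑ a, Real.negMulLog (∑ ω, if ξ ω = a then P ω else 0) := by
  rw [entropyOf, ← Finset.sum_fiberwise (g := ξ)]
  refine Finset.sum_congr rfl fun a _ => ?_
  rw [Finset.sum_filter, Real.negMulLog, neg_mul, ← mul_neg, Finset.sum_mul]
  refine Finset.sum_congr rfl fun ω _ => ?_
  split_ifs with h
  · simp only [classMass, h]
  · simp

/-- A continuity estimate for entropy: if `p` and `q` are close in total variation, then the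
entropy of `q` is not much larger than that of `p`. -/
lemma sum_negMulLog_le [Fintype α] [Nonempty α] (p q : α → ℝ) (hp : ∀ a, 0 ≤ p a)
    (hp1 : ∀ a, p a ≤ 1) (hq : ∀ a, 0 ≤ q a) :
    ∑ a, Real.negMulLog (q a) ≤ ∑ a, Real.negMulLog (p a) +
      (∑ a, |p a - q a|) * (1 + Real.log (Fintype.card α)) + 1 := by
  have hA : (0 : ℝ) < Fintype.card α := by exact_mod_cast Fintype.card_pos
  have hA1 : (1 : ℝ) ≤ Fintype.card α := by exact_mod_cast Fintype.card_pos
  have hlA := Real.log_nonneg hA1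
  have hsub : ∀ a b : ℝ, 0 ≤ a → 0 ≤ b →
      Real.negMulLog (a + b) ≤ Real.negMulLog a + Real.negMulLog b := by
    intro a b ha hb
    rcases ha.eq_or_lt with rfl | ha
    · simp
    rcases hb.eq_or_lt with rfl | hb
    · simp
    have h1 := mul_le_mul_of_nonneg_left (Real.log_le_log ha (by linarith : a ≤ a + b)) ha.le
    have h2 := mul_le_mul_of_nonneg_left (Real.log_le_log hb (by linarith : b ≤ a + b)) hb.le
    simp only [Real.negMulLog]
    linarith
  -- The slope `-log x - 1` of `Real.negMulLog` is at least `-1` on `(0, 1]`.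
  have hmono : ∀ a b : ℝ, 0 ≤ a → a ≤ b → b ≤ 1 →
      Real.negMulLog a ≤ Real.negMulLog b + (b - a) := by
    intro a b ha hab hb
    rcases ha.eq_or_lt with rfl | ha
    · have := Real.negMulLog_nonneg hab hb
      simp; linarith
    have hb0 : 0 < b := by linarith
    have h1 := Real.log_le_sub_one_of_pos (x := b / a) (by positivity)
    rw [Real.log_div hb0.ne' ha.ne'] at h1
    have h2 := mul_le_mul_of_nonneg_left h1 ha.le
    have h3 : a * (b / a - 1) = b - a := by field_simp
    have h4 := mul_nonneg (sub_nonneg.2 hab) (neg_nonneg.2 (Real.log_nonpos hb0.le hb))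
    simp only [Real.negMulLog]
    nlinarith
  -- The terms `(card α)⁻¹` add up to the final `+ 1`, a constant that vanishes after division by
  -- the block length.
  have hsmall : ∀ d : ℝ, 0 ≤ d →
      Real.negMulLog d ≤ d * Real.log (Fintype.card α) + (Fintype.card α : ℝ)⁻¹ := by
    intro d hd
    rcases hd.eq_or_lt with rfl | hd
    · simp
    have h1 := Real.log_le_sub_one_of_pos (x := (d * Fintype.card α)⁻¹) (by positivity)
    rw [Real.log_inv, Real.log_mul hd.ne' hA.ne'] at h1
    have h2 := mul_le_mul_of_nonneg_left h1 hd.le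
    have h3 : d * ((d * Fintype.card α)⁻¹ - 1) = (Fintype.card α : ℝ)⁻¹ - d := by field_simp
    simp only [Real.negMulLog]
    linarith
  have hterm : ∀ a, Real.negMulLog (q a) ≤ Real.negMulLog (p a) +
      |p a - q a| * (1 + Real.log (Fintype.card α)) + (Fintype.card α : ℝ)⁻¹ := by
    intro a
    have hc : (0 : ℝ) ≤ (Fintype.card α : ℝ)⁻¹ := by positivity
    rcases le_total (p a) (q a) with h | h
    · have h1 := hsub (p a) (q a - p a) (hp a) (by linarith)
      have h2 := hsmall (q a - p a) (by linarith)
      rw [abs_of_nonpos (by linarith)]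
      rw [add_sub_cancel] at h1
      nlinarith
    · have h1 := hmono (q a) (p a) (hq a) h (hp1 a)
      rw [abs_of_nonneg (by linarith)]
      nlinarith [mul_nonneg (sub_nonneg.2 h) hlA]
  refine (Finset.sum_le_sum fun a _ => hterm a).trans (le_of_eq ?_)
  rw [Finset.sum_add_distrib, Finset.sum_add_distrib, Finset.sum_mul]
  simp [hA.ne']

end FiniteEntropy

/-! ### Splitting a supermodular set function -/

/-- A supermodular set function splits its total decrease into contributions of the elements,
so that the decrease from any set `V` dominates the contributions of the elements outside `V`. -/
lemma exists_increments {ι : Type*} [DecidableEq ι] (f : Finset ι → ℝ) (L : ι → ℝ)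
    (hL : ∀ j, 0 ≤ L j)
    (hanti : ∀ A j, j ∉ A → 0 ≤ f A - f (insert j A) ∧ f A - f (insert j A) ≤ L j)
    (hsup : ∀ A B j, A ⊆ B → j ∉ B → f A - f (insert j A) ≤ f B - f (insert j B))
    (T : Finset ι) :
    ∃ r : ι → ℝ, (∀ j, 0 ≤ r j ∧ r j ≤ L j) ∧ ∑ j ∈ T, r j = f ∅ - f T ∧
      ∀ V, ∑ j ∈ T \ V, r j ≤ f V - f (V ∪ T) := by
  induction T using Finset.induction_on with
  | empty => exact ⟨0, fun j => ⟨le_rfl, hL j⟩, by simp, fun V => by simp⟩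
  | insert a T ha ih =>
    obtain ⟨r, hr, hs, hV⟩ := ih
    have hupd : ∀ S : Finset ι, a ∉ S →
        ∑ j ∈ S, Function.update r a (f T - f (insert a T)) j = ∑ j ∈ S, r j := fun S hS =>
      Finset.sum_congr rfl fun j hj => Function.update_of_ne (by rintro rfl; exact hS hj) _ _
    -- As in the chain rule, the new element gets the drop it causes after the elements of `T`.
    -- Supermodularity says that the drop is at least as large after `V ∪ T`.
    refine ⟨Function.update r a (f T - f (insert a T)), fun j => ?_, ?_, fun V => ?_⟩
    · by_cases h : j = a
      · subst h
        simpa using hanti T j ha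
      · simpa [Function.update_of_ne h] using hr j
    · rw [Finset.sum_insert ha, hupd T ha, hs, Function.update_self]
      ring
    · by_cases hav : a ∈ V
      · rw [Finset.insert_sdiff_of_mem _ hav, hupd _ (by simp [ha]), Finset.union_insert,
          Finset.insert_eq_of_mem (Finset.mem_union_left _ hav)]
        exact hV V
      · rw [Finset.insert_sdiff_of_notMem _ hav, Finset.sum_insert (by simp [ha]),
          hupd _ (by simp [ha]), Function.update_self, Finset.union_insert]
        have := hsup T (V ∪ T) a Finset.subset_union_right (by simp [ha, hav])
        linarith [hV V]

end Omniscient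

/-! ### One-shot converse for a single code -/

namespace Omniscient

/-- The mass function of independent variables integrates a product of functions of two different
coordinates to the product of the integrals. -/
lemma sum_prod_mul_mul {ι A : Type*} [Fintype ι] [DecidableEq ι] [Fintype A] (p : ι → A → ℝ)
    (hp : ∀ l, ∑ a, p l a = 1) {i k : ι} (hik : i ≠ k) (u v : A → ℝ) :
    ∑ x : ι → A, (∏ l, p l (x l)) * (u (x i) * v (x k)) =
      (∑ a, p i a * u a) * ∑ a, p k a * v a := by
  have h1 : ∀ x : ι → A, (∏ l, p l (x l)) * (u (x i) * v (x k)) =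
      ∏ l, (p l (x l) * ((if l = i then u (x l) else 1) * (if l = k then v (x l) else 1))) := by
    intro x
    simp only [Finset.prod_mul_distrib, Finset.prod_ite_eq', Finset.mem_univ, if_true]
  have h2 : ∀ l, ∑ a, (p l a * ((if l = i then u a else 1) * (if l = k then v a else 1))) =
      (if l = i then ∑ a, p l a * u a else 1) * (if l = k then ∑ a, p l a * v a else 1) := by
    intro l
    by_cases hi : l = i
    · have hk : l ≠ k := fun h => hik (hi ▸ h)
      simp [hi, hik]
    · by_cases hk : l = k
      · simp [hk, hik.symm]
      · simp [hi, hk, hp]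
  simp only [h1]
  rw [← Fintype.piFinset_univ, ← Finset.prod_univ_sum (fun _ => Finset.univ)
    (fun l a => p l a * ((if l = i then u a else 1) * (if l = k then v a else 1)))]
  simp only [h2, Finset.prod_mul_distrib, Finset.prod_ite_eq', Finset.mem_univ, if_true]

lemma sum_toReal_eq_one {α : Type*} [Fintype α] (p : PMF α) : ∑ a, (p a).toReal = 1 := by
  rw [← ENNReal.toReal_sum fun a _ => p.apply_ne_top a, ← tsum_fintype (L := .unconditional _),
    p.tsum_coe, ENNReal.toReal_one]

namespace SimulationCode

variable {t h : ℕ} {V : Fin t → Finset (Fin h)} {𝒳 : Type*} {n N : ℕ} {K : Fin h → ℕ}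

/-- The joint mass function of a code, as a function on one finite sample space. -/
noncomputable def mass (c : SimulationCode V (fun _ => 𝒳) n N K)
    (ω : (∀ j, Fin (K j)) × Fin N × (Fin t → Fin n → 𝒳)) : ℝ :=
  c.joint ω.1 ω.2.1 ω.2.2

lemma mass_nonneg (c : SimulationCode V (fun _ => 𝒳) n N K)
    (ω : (∀ j, Fin (K j)) × Fin N × (Fin t → Fin n → 𝒳)) : 0 ≤ c.mass ω := by
  unfold mass joint
  positivity

lemma induced_nonneg (c : SimulationCode V (fun _ => 𝒳) n N K) (x : Fin t → Fin n → 𝒳) :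
    0 ≤ c.induced x :=
  Finset.sum_nonneg fun w _ => Finset.sum_nonneg fun m _ => c.mass_nonneg (w, m, x)

variable [Fintype 𝒳]

lemma sum_prod_processor (c : SimulationCode V (fun _ => 𝒳) n N K) (w : ∀ j, Fin (K j))
    (m : Fin N) :
    ∑ x : Fin t → Fin n → 𝒳, ∏ i, (c.processor i m (fun j => w j) (x i)).toReal = 1 := by
  classical
  rw [← Fintype.piFinset_univ, ← Finset.prod_univ_sum (fun _ => Finset.univ)
    (fun i a => (c.processor i m (fun j => w j) a).toReal)]
  simp [sum_toReal_eq_one]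

lemma sum_joint (c : SimulationCode V (fun _ => 𝒳) n N K) (w : ∀ j, Fin (K j)) :
    ∑ m : Fin N, ∑ x : Fin t → Fin n → 𝒳, c.joint w m x = ∏ j, (K j : ℝ)⁻¹ := by
  simp only [joint, ← Finset.sum_div, ← Finset.mul_sum, sum_prod_processor, mul_one,
    sum_toReal_eq_one, Finset.prod_inv_distrib, one_div]

/-- The mass of the values of the sources in `S`. -/
lemma classMass_restrict (c : SimulationCode V (fun _ => 𝒳) n N K) (hK : ∀ j, 0 < K j)
    (S : Finset (Fin h)) (ω : (∀ j, Fin (K j)) × Fin N × (Fin t → Fin n → 𝒳)) :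
    classMass c.mass (fun ω => fun j : S => ω.1 j) ω = ∏ j ∈ S, (K j : ℝ)⁻¹ := by
  classical
  have h1 : ∀ w : ∀ j, Fin (K j),
      (if (fun j : S => w j) = (fun j : S => ω.1 j) then ∏ j, (K j : ℝ)⁻¹ else 0) =
        ∏ j, (if j ∈ S → w j = ω.1 j then (K j : ℝ)⁻¹ else 0) := by
    intro w
    by_cases hw : ∀ j, j ∈ S → w j = ω.1 j
    · rw [if_pos (funext fun j : S => hw j j.2)]
      exact Finset.prod_congr rfl fun j _ => by rw [if_pos (hw j)]
    · rw [if_neg fun h => hw fun j hj => congrFun h ⟨j, hj⟩]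
      push Not at hw
      obtain ⟨j, hj, hne⟩ := hw
      rw [Finset.prod_eq_zero (Finset.mem_univ j)]
      rw [if_neg fun h => hne (h hj)]
  have h2 : classMass c.mass (fun ω => fun j : S => ω.1 j) ω = ∑ w : ∀ j, Fin (K j),
      (if (fun j : S => w j) = (fun j : S => ω.1 j) then ∏ j, (K j : ℝ)⁻¹ else 0) := by
    unfold classMass
    rw [Fintype.sum_prod_type]
    refine Finset.sum_congr rfl fun w _ => ?_
    by_cases hw : (fun j : S => w j) = (fun j : S => ω.1 j)
    · simp only [hw, if_true]
      rw [Fintype.sum_prod_type]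
      exact c.sum_joint w
    · simp [hw]
  rw [h2]
  simp only [h1]
  rw [← Fintype.piFinset_univ, ← Finset.prod_univ_sum (fun _ => Finset.univ)
    (fun j a => if j ∈ S → a = ω.1 j then (K j : ℝ)⁻¹ else 0),
    ← Finset.prod_subset (Finset.subset_univ S)]
  · refine Finset.prod_congr rfl fun j hj => ?_
    simp [hj]
  · intro j _ hj
    have : (K j : ℝ) ≠ 0 := by exact_mod_cast (hK j).ne'
    simp [hj, this]

lemma sum_mass (c : SimulationCode V (fun _ => 𝒳) n N K) (hK : ∀ j, 0 < K j) :
    ∑ ω, c.mass ω = 1 := by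
  rw [Fintype.sum_prod_type]
  simp only [Fintype.sum_prod_type, mass, sum_joint, Finset.sum_const, nsmul_eq_mul]
  have : (∏ j, (K j : ℝ)) ≠ 0 := Finset.prod_ne_zero_iff.2 fun j _ => by
    exact_mod_cast (hK j).ne'
  simp [this]

lemma entropyOf_restrict (c : SimulationCode V (fun _ => 𝒳) n N K) (hK : ∀ j, 0 < K j)
    (S : Finset (Fin h)) :
    entropyOf c.mass (fun ω => fun j : S => ω.1 j) = ∑ j ∈ S, Real.log (K j) := by
  unfold entropyOf
  simp only [c.classMass_restrict hK]
  rw [← Finset.sum_mul, c.sum_mass hK, one_mul, Finset.prod_inv_distrib, Real.log_inv, neg_neg,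
    Real.log_prod]
  intro j _
  exact_mod_cast (hK j).ne'

lemma sum_induced (c : SimulationCode V (fun _ => 𝒳) n N K) (g : (Fin t → Fin n → 𝒳) → ℝ) :
    ∑ ω, c.mass ω * g ω.2.2 = ∑ x, c.induced x * g x := by
  simp only [Fintype.sum_prod_type, mass, induced, Finset.sum_mul]
  conv_rhs => rw [Finset.sum_comm]
  refine Finset.sum_congr rfl fun w _ => ?_
  rw [Finset.sum_comm]

open Classical in
/-- The best guess of the output of processor `i` from its inputs is wrong at most as often as
the outputs of `i` and of another processor `k` differ. -/
lemma exists_guess (c : SimulationCode V (fun _ => 𝒳) n N K) [Nonempty 𝒳] {i k : Fin t}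
    (hik : i ≠ k) :
    ∃ g : Fin N → (∀ j : V i, Fin (K j)) → (Fin n → 𝒳),
      ∑ ω, c.mass ω * (if ω.2.2 i = g ω.2.1 (fun j => ω.1 j) then 0 else 1) ≤
        ∑ ω, c.mass ω * (if ω.2.2 i = ω.2.2 k then 0 else 1) := by
  have hmax : ∀ m v, ∃ a, ∀ b, (c.processor i m v b).toReal ≤ (c.processor i m v a).toReal :=
    fun m v => Finite.exists_max _
  -- `g` is the maximum-likelihood guess.
  choose g hg using hmax
  refine ⟨g, ?_⟩
  have hflip : ∀ (E : Prop) [Decidable E], (if E then (0 : ℝ) else 1) = 1 - if E then 1 else 0 := by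
    intro E _
    split_ifs <;> simp
  simp only [hflip, mul_sub, mul_one, Finset.sum_sub_distrib]
  refine sub_le_sub_left ?_ _
  simp only [Fintype.sum_prod_type, mass, joint]
  refine Finset.sum_le_sum fun w _ => Finset.sum_le_sum fun m _ => ?_
  -- With `w` and `m` fixed the outputs are independent with laws `p l`. Agreement of `i` and `k`
  -- then has probability `∑ a, p i a * p k a`, an average of `p i`, hence at most its maximum `p i
  -- b`.
  set p : Fin t → (Fin n → 𝒳) → ℝ := fun l a => (c.processor l m (fun j => w j) a).toReal with hp
  have hp1 : ∀ l, ∑ a, p l a = 1 := fun l => sum_toReal_eq_one _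
  have hp0 : ∀ l a, 0 ≤ p l a := fun l a => ENNReal.toReal_nonneg
  set b := g m fun j => w j
  have hfac : ∀ (E : (Fin t → Fin n → 𝒳) → ℝ),
      ∑ x, (c.coordinator w m).toReal * (∏ l, (c.processor l m (fun j => w j) (x l)).toReal) /
        (∏ j, (K j : ℝ)) * E x =
      (c.coordinator w m).toReal / (∏ j, (K j : ℝ)) * ∑ x, (∏ l, p l (x l)) * E x := by
    intro E
    rw [Finset.mul_sum]
    refine Finset.sum_congr rfl fun x _ => ?_
    simp only [hp]
    ring
  rw [hfac (fun x => if x i = x k then 1 else 0), hfac (fun x => if x i = b then 1 else 0)]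
  refine mul_le_mul_of_nonneg_left ?_ (by positivity)
  have hR : ∑ x : Fin t → Fin n → 𝒳, (∏ l, p l (x l)) * (if x i = b then 1 else 0) = p i b := by
    have := sum_prod_mul_mul p hp1 hik (fun a => if a = b then 1 else 0) (fun _ => 1)
    simpa [hp1] using this
  have hL : ∑ x : Fin t → Fin n → 𝒳, (∏ l, p l (x l)) * (if x i = x k then 1 else 0) = ∑ a, p i a * p k a := by
    have h1 : ∀ a, p i a * p k a = ∑ x : Fin t → Fin n → 𝒳, (∏ l, p l (x l)) *
        ((if x i = a then 1 else 0) * (if x k = a then 1 else 0)) := fun a => by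
      have := sum_prod_mul_mul p hp1 hik (fun b => if b = a then 1 else 0)
        (fun b => if b = a then 1 else 0)
      rw [this]
      simp
    simp only [h1]
    rw [Finset.sum_comm]
    refine Finset.sum_congr rfl fun x _ => ?_
    rw [← Finset.mul_sum]
    congr 1
    by_cases hx : x i = x k
    · simp [hx]
    · simp [hx, eq_comm]
  rw [hR, hL]
  calc ∑ a, p i a * p k a ≤ ∑ a, p i b * p k a :=
        Finset.sum_le_sum fun a _ => mul_le_mul_of_nonneg_right (hg _ _ a) (hp0 k a)
    _ = p i b := by rw [← Finset.mul_sum, hp1, mul_one]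

open Classical in
/-- If the outputs agree up to probability `δ`, then the conditional entropy of the output given
the sources of any processor is at most the logarithm of the number of messages, up to terms
controlled by `δ`. -/
lemma entropyOf_output_le (c : SimulationCode V (fun _ => 𝒳) n N K) [Nonempty 𝒳] (ht : 2 ≤ t)
    (hK : ∀ j, 0 < K j) {δ : ℝ}
    (hδ : ∀ i k, ∑ ω, c.mass ω * (if ω.2.2 i = ω.2.2 k then 0 else 1) ≤ δ) (i₀ i : Fin t) :
    entropyOf c.mass (fun ω => ((fun j : V i => ω.1 j), ω.2.2 i₀)) -
      entropyOf c.mass (fun ω => fun j : V i => ω.1 j) ≤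
      Real.log (2 * N) + 2 * δ * Real.log (2 * Fintype.card (Fin n → 𝒳)) := by
  have : Nontrivial (Fin t) := Fin.nontrivial_iff_two_le.2 ht
  -- Only agreement with a second processor makes the output of `i` predictable from its inputs;
  -- this is where `2 ≤ t` is needed.
  obtain ⟨k, hk⟩ := exists_ne i
  obtain ⟨g, hg⟩ := c.exists_guess hk.symm
  set M : ℝ := (Fintype.card (Fin n → 𝒳) : ℝ) with hM
  have hM1 : 1 ≤ M := by
    rw [hM]
    exact_mod_cast Fintype.card_pos (α := Fin n → 𝒳)
  have hN : 1 ≤ (N : ℝ) := by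
    rcases Nat.eq_zero_or_pos N with rfl | hN
    · have := c.sum_mass hK
      simp at this
    · exact_mod_cast hN
  -- Half of the mass is shared by the guesses belonging to the `N` messages, half is uniform on all
  -- words. A right guess costs `log (2 * N)`, and a wrong one never more than `log (2 * M)`.
  set Q : (∀ j : V i, Fin (K j)) → (Fin n → 𝒳) → ℝ := fun v a =>
    (∑ m, if g m v = a then (2 * N : ℝ)⁻¹ else 0) + (2 * M)⁻¹ with hQ
  have hQs : ∀ v a, 0 ≤ ∑ m, if g m v = a then (2 * N : ℝ)⁻¹ else 0 := fun v a =>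
    Finset.sum_nonneg fun m _ => by split_ifs <;> positivity
  have hQM : ∀ v a, (2 * M)⁻¹ ≤ Q v a := fun v a => le_add_of_nonneg_left (hQs v a)
  have hQ0 : ∀ v a, 0 < Q v a := fun v a => lt_of_lt_of_le (by positivity) (hQM v a)
  have hQN : ∀ m v, (2 * N : ℝ)⁻¹ ≤ Q v (g m v) := fun m v => by
    have h1 := Finset.single_le_sum (f := fun m' => if g m' v = g m v then (2 * N : ℝ)⁻¹ else 0)
      (fun m' _ => by split_ifs <;> positivity) (Finset.mem_univ m)
    simp only [if_true] at h1
    have h2 : (0 : ℝ) ≤ (2 * M)⁻¹ := by positivity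
    simp only [hQ]
    linarith
  have hQ1 : ∀ v, ∑ a, Q v a ≤ 1 := fun v => by
    simp only [hQ, Finset.sum_add_distrib]
    rw [Finset.sum_comm]
    simp only [Finset.sum_ite_eq, Finset.mem_univ, if_true, Finset.sum_const, Finset.card_univ,
      nsmul_eq_mul, Fintype.card_fin, ← hM]
    have : (0 : ℝ) < N := by linarith
    have : (0 : ℝ) < M := by linarith
    apply le_of_eq
    field_simp
    norm_num
  have hlN : 0 ≤ Real.log (2 * N) := Real.log_nonneg (by linarith)
  have hlM : 0 ≤ Real.log (2 * M) := Real.log_nonneg (by linarith)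
  refine (entropyOf_prod_sub_le c.mass_nonneg _ (fun ω => ω.2.2 i₀) Q (fun v a => (hQ0 v a).le)
    hQ1 (fun ω _ => hQ0 _ _)).trans ?_
  -- Two bad events, each of probability at most `δ`: output `i₀` differs from output `i`, or the
  -- guess of output `i` fails.
  have hterm : ∀ ω : (∀ j, Fin (K j)) × Fin N × (Fin t → Fin n → 𝒳),
      c.mass ω * -Real.log (Q (fun j => ω.1 j) (ω.2.2 i₀)) ≤
      c.mass ω * Real.log (2 * N) +
        (c.mass ω * (if ω.2.2 i₀ = ω.2.2 i then 0 else 1) +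
          c.mass ω * (if ω.2.2 i = g ω.2.1 (fun j => ω.1 j) then 0 else 1)) *
          Real.log (2 * M) := by
    intro ω
    rw [← mul_add, mul_assoc, ← mul_add]
    refine mul_le_mul_of_nonneg_left ?_ (c.mass_nonneg ω)
    have hcase : -Real.log (Q (fun j => ω.1 j) (ω.2.2 i₀)) ≤ Real.log (2 * M) := by
      rw [neg_le, ← Real.log_inv]
      exact Real.log_le_log (by positivity) (hQM _ _)
    by_cases h1 : ω.2.2 i₀ = ω.2.2 i
    · by_cases h2 : ω.2.2 i = g ω.2.1 (fun j => ω.1 j)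
      · have h3 : ω.2.2 i₀ = g ω.2.1 (fun j => ω.1 j) := h1.trans h2
        rw [if_pos h1, if_pos h2, h3, add_zero, zero_mul, add_zero, neg_le, ← Real.log_inv]
        exact Real.log_le_log (by positivity) (hQN _ _)
      · rw [if_pos h1, if_neg h2]
        linarith
    · rw [if_neg h1]
      split_ifs <;> linarith
  refine (Finset.sum_le_sum fun ω _ => hterm ω).trans ?_
  rw [Finset.sum_add_distrib, ← Finset.sum_mul, c.sum_mass hK, one_mul, ← Finset.sum_mul,
    Finset.sum_add_distrib]
  have := hδ i₀ i
  have := hδ i k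
  gcongr
  linarith

open Classical in
/-- The one-shot converse bound: the entropy of an output splits into source contributions and a
remainder that satisfy the inequalities of the rate region up to error terms. -/
lemma exists_rates (c : SimulationCode V (fun _ => 𝒳) n N K) [Nonempty 𝒳] (ht : 2 ≤ t)
    (hK : ∀ j, 0 < K j) {δ : ℝ}
    (hδ : ∀ i k, ∑ ω, c.mass ω * (if ω.2.2 i = ω.2.2 k then 0 else 1) ≤ δ) (i₀ : Fin t) :
    ∃ (r : ℝ) (r' : Fin h → ℝ), 0 ≤ r ∧ (∀ j, 0 ≤ r' j) ∧ (∀ j, r' j ≤ Real.log (K j)) ∧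
      (∀ i, (∑ j with j ∉ V i, r' j) + r ≤
        Real.log (2 * N) + 2 * δ * Real.log (2 * Fintype.card (Fin n → 𝒳))) ∧
      r + ∑ j, r' j = ∑ a, Real.negMulLog (∑ x, c.induced x * if x i₀ = a then 1 else 0) := by
  set G : Finset (Fin h) → ℝ := fun S =>
    entropyOf c.mass (fun ω => ((fun j : S => ω.1 j), ω.2.2 i₀)) with hG
  -- The conditional entropy of the output given the sources in `S`, as these are independent and
  -- uniform.
  set f : Finset (Fin h) → ℝ := fun S => G S - ∑ j ∈ S, Real.log (K j) with hf
  have hins : ∀ (A : Finset (Fin h)) (j : Fin h), G (insert j A) = entropyOf c.mass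
      (fun ω => (((fun j : A => ω.1 j), ω.2.2 i₀), ω.1 j)) := by
    intro A j
    refine entropyOf_congr _ fun ω ω' => ?_
    simp only [Prod.mk.injEq, funext_iff, Subtype.forall, Finset.mem_insert]
    constructor
    · rintro ⟨h1, h2⟩
      exact ⟨⟨fun a ha => h1 a (Or.inr ha), h2⟩, h1 j (Or.inl rfl)⟩
    · rintro ⟨⟨h1, h2⟩, h3⟩
      refine ⟨fun a ha => ?_, h2⟩
      rcases ha with rfl | ha
      exacts [h3, h1 a ha]
  have hdiff : ∀ (A : Finset (Fin h)) (j : Fin h), j ∉ A →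
      f A - f (insert j A) = Real.log (K j) - (G (insert j A) - G A) := by
    intro A j hj
    simp only [hf]
    rw [Finset.sum_insert hj]
    ring
  have hpos : ∀ S, 0 ≤ f S := by
    intro S
    simp only [hf, hG]
    rw [← c.entropyOf_restrict hK S, sub_nonneg]
    refine entropyOf_mono c.mass_nonneg fun ω ω' hh => ?_
    simp only [Prod.mk.injEq] at hh
    exact hh.1
  have hanti : ∀ A j, j ∉ A →
      0 ≤ f A - f (insert j A) ∧ f A - f (insert j A) ≤ Real.log (K j) := by
    intro A j hj
    rw [hdiff A j hj]
    have h1 := entropyOf_prod_le_log_card c.mass_nonneg (c.sum_mass hK)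
      (fun ω => ((fun j : A => ω.1 j), ω.2.2 i₀)) (fun ω => ω.1 j)
    rw [← hins, Fintype.card_fin] at h1
    have h2 : G A ≤ G (insert j A) := by
      rw [hins]
      refine entropyOf_mono c.mass_nonneg fun ω ω' hh => ?_
      simp only [Prod.mk.injEq] at hh ⊢
      exact hh.1
    simp only [hG] at h1 h2 ⊢
    constructor <;> linarith
  -- The drop is `log (K j)` minus the conditional entropy of source `j` given the sources in `A`
  -- and the output. Conditioning on more sources lowers the entropy subtracted.
  have hsup : ∀ A B j, A ⊆ B → j ∉ B → f A - f (insert j A) ≤ f B - f (insert j B) := by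
    intro A B j hAB hj
    rw [hdiff A j fun h => hj (hAB h), hdiff B j hj]
    have h1 := entropyOf_submodular c.mass_nonneg
      (fun ω => ((fun j : A => ω.1 j), ω.2.2 i₀)) (fun ω => fun j : B => ω.1 j)
      (fun ω => ω.1 j)
    rw [← hins] at h1
    have h2 : entropyOf c.mass (fun ω => (((fun j : A => ω.1 j), ω.2.2 i₀),
        fun j : B => ω.1 j)) = G B := by
      refine entropyOf_congr _ fun ω ω' => ?_
      simp only [Prod.mk.injEq, funext_iff, Subtype.forall]
      exact ⟨fun hh => ⟨hh.2, hh.1.2⟩, fun hh => ⟨⟨fun a ha => hh.1 a (hAB ha), hh.2⟩, hh.1⟩⟩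
    have h3 : entropyOf c.mass (fun ω => ((((fun j : A => ω.1 j), ω.2.2 i₀),
        fun j : B => ω.1 j), ω.1 j)) = G (insert j B) := by
      rw [hins]
      refine entropyOf_congr _ fun ω ω' => ?_
      simp only [Prod.mk.injEq, funext_iff, Subtype.forall]
      exact ⟨fun hh => ⟨⟨hh.1.2, hh.1.1.2⟩, hh.2⟩,
        fun hh => ⟨⟨⟨fun a ha => hh.1.1 a (hAB ha), hh.1.2⟩, hh.1.1⟩, hh.2⟩⟩
    rw [h2, h3] at h1
    simp only [hG] at h1 ⊢
    linarith
  obtain ⟨r', hr', hsum, hV⟩ := exists_increments f (fun j => Real.log (K j))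
    (fun j => Real.log_natCast_nonneg _) hanti hsup Finset.univ
  refine ⟨f Finset.univ, r', hpos _, fun j => (hr' j).1, fun j => (hr' j).2, fun i => ?_, ?_⟩
  · have h1 := hV (V i)
    have h2 := c.entropyOf_output_le ht hK hδ i₀ i
    rw [c.entropyOf_restrict hK] at h2
    have h3 : f (V i) = G (V i) - ∑ j ∈ V i, Real.log (K j) := rfl
    have h4 : Finset.univ.filter (fun j => j ∉ V i) = Finset.univ \ V i := by
      ext j
      simp
    rw [Finset.union_eq_right.2 (Finset.subset_univ _)] at h1
    rw [h4]
    simp only [hG] at h3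
    linarith
  · rw [hsum]
    have h1 : G ∅ = entropyOf c.mass (fun ω => ω.2.2 i₀) :=
      entropyOf_congr _ fun ω ω' => by simp [funext_iff]
    have h2 : f ∅ = G ∅ := by simp [hf]
    rw [add_sub_cancel, h2, h1, entropyOf_eq_sum_negMulLog]
    refine Finset.sum_congr rfl fun a _ => ?_
    rw [← c.sum_induced (fun x => if x i₀ = a then 1 else 0)]
    congr 1
    refine Finset.sum_congr rfl fun ω _ => ?_
    split_ifs <;> simp

end SimulationCode

end Omniscient

/-! ### One-shot achievability: colouring, approximation, residues -/

namespace Omniscient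

/-- Greedy colouring: a symmetric relation with fewer than `D` neighbours at each point has a
proper colouring with `D` colours. -/
lemma exists_coloring {I : Type*} [Fintype I] (C : I → I → Prop) (hC : ∀ u v, C u v → C v u)
    [DecidableRel C] (D : ℕ) (hD0 : 0 < D)
    (hD : ∀ v, (Finset.univ.filter fun u => C u v).card < D) :
    ∃ col : I → Fin D, ∀ u v, u ≠ v → C u v → col u ≠ col v := by
  classical
  suffices h : ∀ S : Finset I, ∃ col : I → Fin D,
      ∀ u ∈ S, ∀ v ∈ S, u ≠ v → C u v → col u ≠ col v by
    obtain ⟨col, hcol⟩ := h Finset.univ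
    exact ⟨col, fun u v => hcol u (Finset.mem_univ _) v (Finset.mem_univ _)⟩
  intro S
  induction S using Finset.induction_on with
  | empty => exact ⟨fun _ => ⟨0, hD0⟩, by simp⟩
  | insert a S ha ih =>
    obtain ⟨col, hcol⟩ := ih
    have hlt : ((Finset.univ.filter fun u => C u a).image col).card <
        (Finset.univ : Finset (Fin D)).card := by
      rw [Finset.card_univ, Fintype.card_fin]
      exact Finset.card_image_le.trans_lt (hD a)
    obtain ⟨d, -, hd⟩ := Finset.exists_mem_notMem_of_card_lt_card hlt
    have hd' : ∀ u, C u a → col u ≠ d := fun u hu he =>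
      hd (Finset.mem_image.2 ⟨u, by simpa using hu, he⟩)
    refine ⟨Function.update col a d, fun u hu v hv huv huC => ?_⟩
    rcases Finset.mem_insert.1 hu with rfl | hu
    · have hv' := (Finset.mem_insert.1 hv).resolve_left huv.symm
      rw [Function.update_self, Function.update_of_ne huv.symm]
      exact (hd' v (hC _ _ huC)).symm
    · rcases Finset.mem_insert.1 hv with rfl | hv
      · rw [Function.update_self, Function.update_of_ne huv]
        exact hd' u huC
      · have hua : u ≠ a := fun h => ha (h ▸ hu)
        have hva : v ≠ a := fun h => ha (h ▸ hv)
        rw [Function.update_of_ne hua, Function.update_of_ne hva]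
        exact hcol u hu v hv huv huC

open Classical in
/-- A mass function with small atoms can be mapped to approximate any target distribution. -/
lemma exists_map_approx {I A : Type*} [Fintype I] [Fintype A] [Nonempty A] (P : I → ℝ) (q : A → ℝ)
    (hP : ∀ b, 0 ≤ P b) (hq : ∀ a, 0 ≤ q a) (hPq : ∑ b, P b = ∑ a, q a) {ε : ℝ}
    (hε : 0 ≤ ε) (hPε : ∀ b, P b ≤ ε) :
    ∃ φ : I → A, ∑ a, |(∑ b, if φ b = a then P b else 0) - q a| ≤ 2 * ∑ a, min (q a) ε := by
  -- Greedy filling: each atom goes to a point that still has room. If none has room, every deficit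
  -- is already below `ε`, and the remaining atoms may go anywhere.
  have key : ∀ S : Finset I, ∃ φ : I → A,
      (∀ a, (∑ b ∈ S, if φ b = a then P b else 0) ≤ q a) ∨
      (∀ a, q a - min (q a) ε ≤ ∑ b ∈ S, if φ b = a then P b else 0) := by
    intro S
    induction S using Finset.induction_on with
    | empty => exact ⟨fun _ => Classical.arbitrary A, Or.inl fun a => by simpa using hq a⟩
    | insert b₀ S hb ih =>
      obtain ⟨φ, h | h⟩ := ih
      · by_cases hx : ∃ a, (∑ b ∈ S, if φ b = a then P b else 0) + P b₀ ≤ q a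
        · obtain ⟨a₀, ha₀⟩ := hx
          refine ⟨Function.update φ b₀ a₀, Or.inl fun a => ?_⟩
          rw [Finset.sum_insert hb, Function.update_self]
          have : (∑ b ∈ S, if Function.update φ b₀ a₀ b = a then P b else 0) =
              ∑ b ∈ S, if φ b = a then P b else 0 := by
            refine Finset.sum_congr rfl fun b hbS => ?_
            rw [Function.update_of_ne (by rintro rfl; exact hb hbS)]
          rw [this]
          by_cases e : a₀ = a
          · subst e
            rw [if_pos rfl]
            linarith
          · rw [if_neg e]
            linarith [h a]
        · push Not at hx
          refine ⟨φ, Or.inr fun a => ?_⟩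
          rw [Finset.sum_insert hb]
          have h0 : 0 ≤ if φ b₀ = a then P b₀ else 0 := by split_ifs <;> simp [hP]
          have h1 : 0 ≤ ∑ b ∈ S, if φ b = a then P b else 0 :=
            Finset.sum_nonneg fun b _ => by split_ifs <;> simp [hP]
          have h2 := hx a
          have h3 := hPε b₀
          rcases min_cases (q a) ε with h4 | h4 <;> linarith
      · refine ⟨φ, Or.inr fun a => ?_⟩
        rw [Finset.sum_insert hb]
        have h0 : 0 ≤ if φ b₀ = a then P b₀ else 0 := by split_ifs <;> simp [hP]
        linarith [h a]
  obtain ⟨φ, hφ⟩ := key Finset.univ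
  have htot : ∑ a, ∑ b, (if φ b = a then P b else 0) = ∑ a, q a := by
    rw [Finset.sum_comm, ← hPq]
    simp
  have hr : ∀ a, q a - min (q a) ε ≤ ∑ b, if φ b = a then P b else 0 := by
    -- If no point overflows, equality of the total masses makes the fit exact.
    rcases hφ with h | h
    · have := (Finset.sum_eq_sum_iff_of_le fun a _ => h a).1 htot
      intro a
      rw [this a (Finset.mem_univ a)]
      have : 0 ≤ min (q a) ε := le_min (hq a) hε
      linarith
    · exact h
  refine ⟨φ, ?_⟩
  -- Deficits are at most `min (q a) ε`, and the signed differences sum to zero, so the deficits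
  -- control the surpluses as well.
  have hterm : ∀ a, |(∑ b, if φ b = a then P b else 0) - q a| ≤
      ((∑ b, if φ b = a then P b else 0) - q a) + 2 * min (q a) ε := by
    intro a
    have h1 := hr a
    have h2 : 0 ≤ min (q a) ε := le_min (hq a) hε
    rw [abs_le]
    constructor <;> linarith
  refine (Finset.sum_le_sum fun a _ => hterm a).trans (le_of_eq ?_)
  rw [Finset.sum_add_distrib, Finset.sum_sub_distrib, htot, Finset.mul_sum]
  ring

/-- An element of a residue class is determined by its quotient, which lies in `{0, …, K / K'}`. -/
lemma card_mod_fiber_le (K K' : ℕ) (hK' : 0 < K') (c : Fin K') :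
    (Finset.univ.filter fun w : Fin K => (⟨w % K', Nat.mod_lt _ hK'⟩ : Fin K') = c).card ≤
      K / K' + 1 := by
  rw [← Finset.card_range (K / K' + 1)]
  refine Finset.card_le_card_of_injOn (fun w : Fin K => (w : ℕ) / K') (fun w _ => ?_)
    fun w hw w' hw' he => ?_
  · simp only [Finset.coe_range, Set.mem_Iio]
    exact Nat.lt_succ_of_le (Nat.div_le_div_right w.2.le)
  · simp only [Finset.coe_filter, Finset.mem_univ, true_and, Set.mem_ofPred_eq] at hw hw'
    have h1 : (w : ℕ) % K' = (w' : ℕ) % K' := congrArg Fin.val (hw.trans hw'.symm)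
    apply Fin.ext
    rw [← Nat.div_add_mod (w : ℕ) K', ← Nat.div_add_mod (w' : ℕ) K', h1]
    exact congrArg (fun z => K' * z + (w' : ℕ) % K') he

section Code

variable {t h : ℕ} {𝒳 : Type*} {n N N₀ : ℕ} {K K' : Fin h → ℕ}

/-- The residue of each source value modulo `K' j`. -/
def residues (hK' : ∀ j, 0 < K' j) (w : ∀ j, Fin (K j)) (j : Fin h) : Fin (K' j) :=
  ⟨w j % K' j, Nat.mod_lt _ (hK' j)⟩

/-- The mass function of a uniform value in `Fin N₀` and the residues of uniform sources. -/
noncomputable def residueMass (K : Fin h → ℕ) (hK' : ∀ j, 0 < K' j)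
    (b : Fin N₀ × ∀ j, Fin (K' j)) : ℝ :=
  ∑ w : ∀ j, Fin (K j), if residues hK' w = b.2 then (N₀ : ℝ)⁻¹ / ∏ j, (K j : ℝ) else 0

lemma residueMass_nonneg (hK' : ∀ j, 0 < K' j) (b : Fin N₀ × ∀ j, Fin (K' j)) :
    0 ≤ residueMass K hK' b :=
  Finset.sum_nonneg fun w _ => by split_ifs <;> positivity

lemma sum_residueMass_mul (hK' : ∀ j, 0 < K' j) (g : (Fin N₀ × ∀ j, Fin (K' j)) → ℝ) :
    ∑ b, residueMass K hK' b * g b = ∑ w : ∀ j, Fin (K j), ∑ b₀ : Fin N₀,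
      (N₀ : ℝ)⁻¹ / (∏ j, (K j : ℝ)) * g (b₀, residues hK' w) := by
  simp only [residueMass, Finset.sum_mul]
  rw [Finset.sum_comm]
  refine Finset.sum_congr rfl fun w _ => ?_
  rw [Fintype.sum_prod_type]
  refine Finset.sum_congr rfl fun b₀ _ => ?_
  rw [Finset.sum_eq_single (residues hK' w)]
  · simp
  · intro b _ hb
    rw [if_neg (Ne.symm hb), zero_mul]
  · simp

lemma sum_residueMass (hN₀ : 0 < N₀) (hK' : ∀ j, 0 < K' j) (hK : ∀ j, 0 < K j) :
    ∑ b : Fin N₀ × ∀ j, Fin (K' j), residueMass K hK' b = 1 := by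
  have h1 := sum_residueMass_mul (K := K) (N₀ := N₀) hK' fun _ => 1
  simp only [mul_one] at h1
  rw [h1]
  have h2 : (∏ j, (K j : ℝ)) ≠ 0 := Finset.prod_ne_zero_iff.2 fun j _ => by
    exact_mod_cast (hK j).ne'
  have h3 : (N₀ : ℝ) ≠ 0 := by exact_mod_cast hN₀.ne'
  simp only [Finset.sum_const, Finset.card_univ, Fintype.card_pi, Fintype.card_fin, nsmul_eq_mul,
    Nat.cast_prod]
  field_simp

/-- The coordinates are independent. Each residue class has at most `K / K' + 1 ≤ 2 * (K / K')`
elements, so non-uniformity costs a factor `2` per source. -/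
lemma residueMass_le (hK' : ∀ j, 0 < K' j) (hKK' : ∀ j, K' j ≤ K j)
    (b : Fin N₀ × ∀ j, Fin (K' j)) :
    residueMass K hK' b ≤ (N₀ : ℝ)⁻¹ * ∏ j, (2 / (K' j : ℝ)) := by
  have h1 : residueMass K hK' b = (N₀ : ℝ)⁻¹ * ∏ j, (((Finset.univ.filter fun w : Fin (K j) =>
      (⟨w % K' j, Nat.mod_lt _ (hK' j)⟩ : Fin (K' j)) = b.2 j).card : ℝ) / (K j : ℝ)) := by
    have h2 : Finset.univ.filter (fun w : ∀ j, Fin (K j) => residues hK' w = b.2) =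
        Fintype.piFinset fun j => Finset.univ.filter fun w : Fin (K j) =>
          (⟨w % K' j, Nat.mod_lt _ (hK' j)⟩ : Fin (K' j)) = b.2 j := by
      ext w
      simp [funext_iff, residues]
    rw [residueMass, ← Finset.sum_filter, h2, Finset.sum_const, Fintype.card_piFinset,
      nsmul_eq_mul, Finset.prod_div_distrib, Nat.cast_prod]
    ring
  rw [h1]
  refine mul_le_mul_of_nonneg_left ?_ (by positivity)
  refine Finset.prod_le_prod (fun j _ => by positivity) fun j _ => ?_
  have hk' : (0 : ℝ) < K' j := by exact_mod_cast hK' j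
  have hkk : (K' j : ℝ) ≤ K j := by exact_mod_cast hKK' j
  have h3 : ((Finset.univ.filter fun w : Fin (K j) =>
      (⟨w % K' j, Nat.mod_lt _ (hK' j)⟩ : Fin (K' j)) = b.2 j).card : ℝ) ≤
      (K j : ℝ) / K' j + 1 := by
    refine le_trans (Nat.cast_le.2 (card_mod_fiber_le _ _ (hK' j) _)) ?_
    push_cast
    gcongr
    exact Nat.cast_div_le
  have h4 : 1 ≤ (K j : ℝ) / K' j := by rwa [one_le_div hk']
  rw [div_le_iff₀ (hk'.trans_le hkk)]
  calc _ ≤ (K j : ℝ) / K' j + 1 := h3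
    _ ≤ 2 * ((K j : ℝ) / K' j) := by linarith
    _ = 2 / (K' j : ℝ) * K j := by ring

/-- The number of tuples that agree with a given one on the coordinates seen by some processor. -/
lemma card_conflict_le {V : Fin t → Finset (Fin h)} (v : Fin N₀ × ∀ j, Fin (K' j)) :
    (Finset.univ.filter fun u : Fin N₀ × ∀ j, Fin (K' j) =>
      ∃ i, ∀ j ∈ V i, u.2 j = v.2 j).card ≤ ∑ i, N₀ * ∏ j with j ∉ V i, K' j := by
  classical
  have h1 : (Finset.univ.filter fun u : Fin N₀ × ∀ j, Fin (K' j) =>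
      ∃ i, ∀ j ∈ V i, u.2 j = v.2 j) ⊆ Finset.univ.biUnion fun i =>
        (Finset.univ : Finset (Fin N₀)) ×ˢ
          Fintype.piFinset fun j => if j ∈ V i then {v.2 j} else Finset.univ := by
    intro u hu
    obtain ⟨i, hi⟩ := (Finset.mem_filter.1 hu).2
    simp only [Finset.mem_biUnion, Finset.mem_univ, true_and, Finset.mem_product,
      Fintype.mem_piFinset]
    refine ⟨i, fun j => ?_⟩
    by_cases hj : j ∈ V i
    · simp [hj, hi j hj]
    · simp [hj]
  refine (Finset.card_le_card h1).trans (Finset.card_biUnion_le.trans (Finset.sum_le_sum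
    fun i _ => le_of_eq ?_))
  rw [Finset.card_product, Fintype.card_piFinset, Finset.card_univ, Fintype.card_fin,
    Finset.prod_filter]
  congr 1
  refine Finset.prod_congr rfl fun j _ => ?_
  by_cases hj : j ∈ V i <;> simp [hj]

open Classical in
/-- One-shot achievability: the coordinator sends a colour of the tuple formed by private
randomness and the residues of the sources, from which every processor recovers the tuple. -/
lemma exists_code [Fintype 𝒳] [Nonempty 𝒳] (V : Fin t → Finset (Fin h)) (i₀ : Fin t)
    (hN₀ : 0 < N₀) (hK' : ∀ j, 0 < K' j) (hKK' : ∀ j, K' j ≤ K j)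
    (hN : ∑ i, N₀ * ∏ j with j ∉ V i, K' j < N) (q : (Fin n → 𝒳) → ℝ) (hq : ∀ a, 0 ≤ q a)
    (hq1 : ∑ a, q a = 1) :
    ∃ c : SimulationCode V (fun _ => 𝒳) n N K,
      ∑ x : Fin t → Fin n → 𝒳, |c.induced x - if ∀ i, x i = x i₀ then q (x i₀) else 0| ≤
        2 * ∑ a, min (q a) ((N₀ : ℝ)⁻¹ * ∏ j, (2 / (K' j : ℝ))) := by
  have hK : ∀ j, 0 < K j := fun j => (hK' j).trans_le (hKK' j)
  have : Nonempty (Fin N₀) := ⟨⟨0, hN₀⟩⟩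
  obtain ⟨φ, hφ⟩ := exists_map_approx (residueMass (N₀ := N₀) K hK') q (residueMass_nonneg hK') hq
    (by rw [sum_residueMass hN₀ hK' hK, hq1]) (by positivity) (residueMass_le hK' hKK')
  obtain ⟨col, hcol⟩ := exists_coloring
    (fun u v : Fin N₀ × ∀ j, Fin (K' j) => ∃ i, ∀ j ∈ V i, u.2 j = v.2 j)
    (fun u v ⟨i, hi⟩ => ⟨i, fun j hj => (hi j hj).symm⟩) N (Nat.zero_lt_of_lt hN)
    (fun v => lt_of_le_of_lt (by convert card_conflict_le v) hN)
  -- Two tuples compatible with the view of processor `i` conflict, so at most one of them has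
  -- colour `m`. If there is none, the output is arbitrary.
  have hdec : ∀ (i : Fin t) (m : Fin N) (v : ∀ j : V i, Fin (K j)), ∃ a : Fin n → 𝒳,
      ∀ b : Fin N₀ × ∀ j, Fin (K' j), col b = m →
        (∀ j : V i, b.2 j = ⟨v j % K' j, Nat.mod_lt _ (hK' j)⟩) → φ b = a := by
    intro i m v
    by_cases hb : ∃ b : Fin N₀ × ∀ j, Fin (K' j), col b = m ∧
        ∀ j : V i, b.2 j = ⟨v j % K' j, Nat.mod_lt _ (hK' j)⟩
    · obtain ⟨b, hb1, hb2⟩ := hb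
      refine ⟨φ b, fun b' h1 h2 => ?_⟩
      by_cases e : b' = b
      · rw [e]
      · exact absurd (h1.trans hb1.symm) (hcol b' b e
          ⟨i, fun j hj => (h2 ⟨j, hj⟩).trans (hb2 ⟨j, hj⟩).symm⟩)
    · exact ⟨Classical.arbitrary _, fun b h1 h2 => absurd ⟨b, h1, h2⟩ hb⟩
  choose dec hdec using hdec
  set c : SimulationCode V (fun _ => 𝒳) n N K :=
    { coordinator := fun w =>
        (PMF.uniformOfFintype (Fin N₀)).map fun b₀ => col (b₀, residues hK' w)
      processor := fun i m v => PMF.pure (dec i m v) } with hc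
  have hcoord : ∀ w m, (c.coordinator w m).toReal =
      ∑ b₀ : Fin N₀, if m = col (b₀, residues hK' w) then (N₀ : ℝ)⁻¹ else 0 := by
    intro w m
    simp only [hc, PMF.map_apply, tsum_fintype]
    rw [ENNReal.toReal_sum fun b₀ _ => by split_ifs <;> simp [hN₀.ne']]
    refine Finset.sum_congr rfl fun b₀ _ => ?_
    split_ifs <;> simp
  have hproc : ∀ (w : ∀ j, Fin (K j)) (b₀ : Fin N₀) (x : Fin t → Fin n → 𝒳),
      ∏ i, (c.processor i (col (b₀, residues hK' w)) (fun j => w j) (x i)).toReal =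
        if ∀ i, x i = φ (b₀, residues hK' w) then 1 else 0 := by
    intro w b₀ x
    have h1 : ∀ i, dec i (col (b₀, residues hK' w)) (fun j => w j) = φ (b₀, residues hK' w) :=
      fun i => (hdec i _ _ (b₀, residues hK' w) rfl fun j => rfl).symm
    simp only [hc, PMF.pure_apply, h1]
    by_cases hx : ∀ i, x i = φ (b₀, residues hK' w)
    · simp [hx]
    · rw [if_neg hx]
      push Not at hx
      obtain ⟨i, hi⟩ := hx
      rw [Finset.prod_eq_zero (Finset.mem_univ i)]
      simp [hi]
  have hind : ∀ x, c.induced x = ∑ b, residueMass (N₀ := N₀) K hK' b *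
      if ∀ i, x i = φ b then 1 else 0 := by
    intro x
    rw [sum_residueMass_mul]
    simp only [SimulationCode.induced, SimulationCode.joint, hcoord]
    refine Finset.sum_congr rfl fun w _ => ?_
    simp only [Finset.sum_mul, Finset.sum_div]
    rw [Finset.sum_comm]
    refine Finset.sum_congr rfl fun b₀ _ => ?_
    rw [Finset.sum_eq_single (col (b₀, residues hK' w))]
    · rw [if_pos rfl, hproc]
      ring
    · intro m _ hm
      rw [if_neg hm]
      simp
    · simp
  refine ⟨c, le_trans (le_of_eq ?_) hφ⟩
  -- Both mass functions live on the diagonal, so the distance on `t`-tuples reduces to the one on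
  -- single words.
  have hterm : ∀ x : Fin t → Fin n → 𝒳,
      |c.induced x - if ∀ i, x i = x i₀ then q (x i₀) else 0| = ∑ a : Fin n → 𝒳,
        if x = fun _ => a then
          |(∑ b, if φ b = a then residueMass (N₀ := N₀) K hK' b else 0) - q a| else 0 := by
    intro x
    by_cases hx : ∀ i, x i = x i₀
    · rw [Finset.sum_eq_single (x i₀), if_pos (funext hx), if_pos hx, hind]
      · congr 2
        refine Finset.sum_congr rfl fun b _ => ?_
        have : (∀ i, x i = φ b) ↔ φ b = x i₀ :=
          ⟨fun hh => (hh i₀).symm, fun hh i => (hx i).trans hh.symm⟩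
        simp only [this, mul_ite, mul_one, mul_zero]
      · intro a _ ha
        rw [if_neg]
        rintro rfl
        exact ha rfl
      · simp
    · rw [if_neg hx, hind, Finset.sum_eq_zero, Finset.sum_eq_zero, sub_zero, abs_zero]
      · intro a _
        rw [if_neg]
        rintro rfl
        exact hx fun _ => rfl
      · intro b _
        rw [if_neg, mul_zero]
        exact fun hh => hx fun i => (hh i).trans (hh i₀).symm
  simp only [hterm]
  rw [Finset.sum_comm]
  refine Finset.sum_congr rfl fun a _ => ?_
  rw [Finset.sum_ite_eq' Finset.univ (fun _ => a), if_pos (Finset.mem_univ _)]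
  congr!

end Code

end Omniscient

/-! ### Product laws, index sizes and the linear region -/

namespace Omniscient

open Classical in
/-- The i.i.d. law of identical components is supported on the diagonal. -/
lemma iid_map_diagonal {t : ℕ} {𝒳 : Type*} (qX : PMF 𝒳) (n : ℕ) (i₀ : Fin t)
    (x : Fin t → Fin n → 𝒳) :
    iid (𝒳 := fun _ => 𝒳) (qX.map fun x => fun _ : Fin t => x) n x =
      if ∀ i, x i = x i₀ then ∏ s, (qX (x i₀ s)).toReal else 0 := by
  have hpt : ∀ y : Fin t → 𝒳, qX.map (fun x => fun _ : Fin t => x) y =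
      if ∀ i, y i = y i₀ then qX (y i₀) else 0 := by
    intro y
    rw [PMF.map_apply]
    by_cases hy : ∀ i, y i = y i₀
    · rw [if_pos hy, tsum_eq_single (y i₀), if_pos (funext hy)]
      intro a ha
      rw [if_neg]
      rintro rfl
      exact ha rfl
    · rw [if_neg hy, ENNReal.tsum_eq_zero]
      intro a
      rw [if_neg]
      rintro rfl
      exact hy fun _ => rfl
  simp only [iid, hpt]
  by_cases hx : ∀ i, x i = x i₀
  · rw [if_pos hx]
    refine Finset.prod_congr rfl fun s _ => ?_
    rw [if_pos fun i => congrFun (hx i) s]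
  · rw [if_neg hx]
    push Not at hx
    obtain ⟨i, hi⟩ := hx
    obtain ⟨s, hs⟩ := Function.ne_iff.1 hi
    refine Finset.prod_eq_zero (Finset.mem_univ s) ?_
    rw [if_neg fun hh => hs (hh i), ENNReal.toReal_zero]

section IID

variable {α : Type*} [Fintype α] (q : α → ℝ)

lemma sum_prod_eq_pow (n : ℕ) : ∑ x : Fin n → α, ∏ s, q (x s) = (∑ a, q a) ^ n := by
  classical
  rw [← Fintype.piFinset_univ, ← Finset.prod_univ_sum (fun _ => Finset.univ) (fun _ a => q a)]
  simp

lemma sum_negMulLog_prod (hq1 : ∑ a, q a = 1) (n : ℕ) :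
    ∑ x : Fin n → α, Real.negMulLog (∏ s, q (x s)) = n * ∑ a, Real.negMulLog (q a) := by
  induction n with
  | zero => simp
  | succ n ih =>
    rw [← (Fin.consEquiv fun _ => α).sum_comp, Fintype.sum_prod_type]
    simp only [Fin.consEquiv_apply, Fin.prod_univ_succ, Fin.cons_zero, Fin.cons_succ,
      Real.negMulLog_mul, Finset.sum_add_distrib, ← Finset.mul_sum, ← Finset.sum_mul, ih,
      sum_prod_eq_pow, hq1, one_pow, one_mul]
    push_cast
    ring

/-- As a function of `s`, the left-hand side equals `1` at `s = 1` with derivative `-H + (H + δ) = δ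
> 0`, so it is below `1` just to the left. -/
lemma exists_rpow_sum_lt_one (hq : ∀ a, 0 ≤ q a) (hq1 : ∑ a, q a = 1) {δ : ℝ} (hδ : 0 < δ) :
    ∃ s : ℝ, 0 < s ∧ s < 1 ∧
      (∑ a, q a ^ s) * Real.exp (-((1 - s) * (∑ a, Real.negMulLog (q a) + δ))) < 1 := by
  set H := ∑ a, Real.negMulLog (q a) with hH
  have hpow : ∀ a, HasDerivAt (fun s : ℝ => q a ^ s) (-Real.negMulLog (q a)) 1 := by
    intro a
    rcases (hq a).eq_or_lt with h0 | h0
    · rw [← h0, Real.negMulLog_zero, neg_zero]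
      refine (hasDerivAt_const (1 : ℝ) (0 : ℝ)).congr_of_eventuallyEq ?_
      filter_upwards [eventually_ne_nhds (one_ne_zero : (1 : ℝ) ≠ 0)] with s hs
      exact Real.zero_rpow hs
    · have := (Real.hasStrictDerivAt_const_rpow h0 1).hasDerivAt
      simpa [Real.negMulLog] using this
  have hsum : HasDerivAt (fun s : ℝ => ∑ a, q a ^ s) (-H) 1 := by
    have := HasDerivAt.fun_sum (u := Finset.univ) fun a _ => hpow a
    simpa [hH] using this
  have hlin : HasDerivAt (fun s : ℝ => -((1 - s) * (H + δ))) (H + δ) 1 := by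
    have := ((((hasDerivAt_id (1 : ℝ)).const_sub 1).mul_const (H + δ)).fun_neg)
    simpa using this
  have hder := hsum.mul hlin.exp
  simp only [Real.rpow_one, hq1, sub_self, zero_mul, neg_zero, Real.exp_zero, mul_one,
    one_mul] at hder
  rw [hasDerivAt_iff_tendsto_slope] at hder
  have h1 := hder.eventually (lt_mem_nhds (by linarith : (0 : ℝ) < -H + (H + δ)))
  have h2 : 𝓝[<] (1 : ℝ) ≤ 𝓝[≠] 1 := nhdsWithin_mono _ fun x hx => ne_of_lt hx
  have h3 : ∀ᶠ s in 𝓝[<] (1 : ℝ), 0 < s := nhdsWithin_le_nhds (lt_mem_nhds one_pos)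
  obtain ⟨s, ⟨hs1, hs2⟩, hs3⟩ := (((h1.filter_mono h2).and h3).and self_mem_nhdsWithin).exists
  refine ⟨s, hs2, hs3, ?_⟩
  have hs3' : s - 1 < 0 := sub_neg.2 hs3
  rw [slope_def_field, div_pos_iff] at hs1
  simp only [Pi.mul_apply, Real.rpow_one, hq1, sub_self, zero_mul, neg_zero, Real.exp_zero,
    mul_one] at hs1
  rcases hs1 with hs1 | hs1
  · linarith [hs1.2]
  · linarith [hs1.1]

/-- Cutting the `n`-fold product of `q` off at a level exponentially smaller than `exp (-n H)`
leaves a vanishing mass. -/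
lemma tendsto_sum_min_prod (hq : ∀ a, 0 ≤ q a) (hq1 : ∑ a, q a = 1) {δ C : ℝ} (hδ : 0 < δ)
    (hC : 0 ≤ C) :
    Tendsto (fun n : ℕ => ∑ x : Fin n → α,
      min (∏ s, q (x s)) (C * Real.exp (-(n * (∑ a, Real.negMulLog (q a) + δ)))))
      atTop (𝓝 0) := by
  obtain ⟨s, hs0, hs1, hs⟩ := exists_rpow_sum_lt_one q hq hq1 hδ
  set H := ∑ a, Real.negMulLog (q a) with hH
  set ρ := (∑ a, q a ^ s) * Real.exp (-((1 - s) * (H + δ))) with hρ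
  have hρ0 : 0 ≤ ρ :=
    mul_nonneg (Finset.sum_nonneg fun a _ => Real.rpow_nonneg (hq a) s) (Real.exp_pos _).le
  -- Chernoff-type bound: the power `s` factors over the letters, so the sum becomes an `n`-th
  -- power.
  have hmin : ∀ a b : ℝ, 0 ≤ a → 0 ≤ b → min a b ≤ a ^ s * b ^ (1 - s) := by
    intro a b ha hb
    have hm : 0 ≤ min a b := le_min ha hb
    calc min a b = min a b ^ s * min a b ^ (1 - s) := by
          rw [← Real.rpow_add' hm (by simp), add_sub_cancel, Real.rpow_one]
      _ ≤ a ^ s * b ^ (1 - s) := mul_le_mul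
          (Real.rpow_le_rpow hm (min_le_left _ _) hs0.le)
          (Real.rpow_le_rpow hm (min_le_right _ _) (by linarith))
          (Real.rpow_nonneg hm _) (Real.rpow_nonneg ha _)
  have hbound : ∀ n : ℕ, ∑ x : Fin n → α,
      min (∏ i, q (x i)) (C * Real.exp (-(n * (H + δ)))) ≤ C ^ (1 - s) * ρ ^ n := by
    intro n
    have hprod : ∀ x : Fin n → α, 0 ≤ ∏ i, q (x i) := fun x =>
      Finset.prod_nonneg fun i _ => hq _
    refine (Finset.sum_le_sum fun x _ => hmin _ _ (hprod x) (by positivity)).trans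
      (le_of_eq ?_)
    rw [← Finset.sum_mul]
    simp only [← Real.finsetProd_rpow _ _ fun i _ => hq _]
    rw [sum_prod_eq_pow (fun a => q a ^ s), Real.mul_rpow hC (Real.exp_pos _).le,
      ← Real.exp_mul, hρ, mul_pow, ← Real.exp_nat_mul]
    ring_nf
  refine squeeze_zero (fun n => Finset.sum_nonneg fun x _ => le_min
    (Finset.prod_nonneg fun i _ => hq _) (by positivity)) hbound ?_
  simpa using (tendsto_pow_atTop_nhds_zero_of_lt_one hρ0 hs).const_mul (C ^ (1 - s))

end IID

section IndexSize

lemma one_le_two_rpow (n : ℕ) {R : ℝ} (hR : 0 ≤ R) : (1 : ℝ) ≤ 2 ^ ((n : ℝ) * R) :=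
  Real.one_le_rpow one_le_two (by positivity)

lemma indexSize_pos (n : ℕ) {R : ℝ} (hR : 0 ≤ R) : 0 < indexSize n R :=
  Nat.floor_pos.2 (one_le_two_rpow n hR)

lemma indexSize_mono (n : ℕ) {R S : ℝ} (h : R ≤ S) : indexSize n R ≤ indexSize n S :=
  Nat.floor_mono (Real.rpow_le_rpow_of_exponent_le one_le_two (by gcongr))

lemma indexSize_le (n : ℕ) (R : ℝ) : (indexSize n R : ℝ) ≤ 2 ^ ((n : ℝ) * R) :=
  Nat.floor_le (by positivity)

lemma two_rpow_le_two_mul_indexSize (n : ℕ) {R : ℝ} (hR : 0 ≤ R) :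
    (2 : ℝ) ^ ((n : ℝ) * R) ≤ 2 * indexSize n R := by
  have h1 := Nat.lt_floor_add_one ((2 : ℝ) ^ ((n : ℝ) * R))
  have h2 : (1 : ℝ) ≤ indexSize n R := by exact_mod_cast indexSize_pos n hR
  unfold indexSize at *
  linarith

lemma log_indexSize_le (n : ℕ) {R : ℝ} (hR : 0 ≤ R) :
    Real.log (indexSize n R) ≤ n * R * Real.log 2 := by
  rw [← Real.log_rpow two_pos]
  exact Real.log_le_log (by exact_mod_cast indexSize_pos n hR) (indexSize_le n R)

end IndexSize

section Region

variable {t h : ℕ}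

/-- The rate region given by linear inequalities, for a source of entropy `H`. -/
def linearRegion (V : Fin t → Finset (Fin h)) (H : ℝ) : Set (ℝ × (Fin h → ℝ)) :=
  {ρ | 0 ≤ ρ.1 ∧ (∀ j, 0 ≤ ρ.2 j) ∧
    ∃ (r : ℝ) (r' : Fin h → ℝ), 0 ≤ r ∧ (∀ j, 0 ≤ r' j) ∧
      (∀ i, (∑ j with j ∉ V i, r' j) + r ≤ ρ.1) ∧ H ≤ r + ∑ j, r' j ∧ ∀ j, r' j ≤ ρ.2 j}

/-- The region projects the closed set `T`. The auxiliary rates are bounded by the rates themselves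
(`r` through any one processor), so a convergent subsequence of them exists. -/
lemma isClosed_linearRegion (ht : 0 < t) (V : Fin t → Finset (Fin h)) (H : ℝ) :
    IsClosed (linearRegion V H) := by
  set T : Set ((ℝ × (Fin h → ℝ)) × (ℝ × (Fin h → ℝ))) :=
    {z | 0 ≤ z.1.1 ∧ (∀ j, 0 ≤ z.1.2 j) ∧ 0 ≤ z.2.1 ∧ (∀ j, 0 ≤ z.2.2 j) ∧
      (∀ i, (∑ j with j ∉ V i, z.2.2 j) + z.2.1 ≤ z.1.1) ∧ H ≤ z.2.1 + ∑ j, z.2.2 j ∧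
      ∀ j, z.2.2 j ≤ z.1.2 j} with hT
  have hTc : IsClosed T := by
    simp only [hT, Set.ofPred_and, Set.ofPred_forall]
    refine IsClosed.inter ?_ (IsClosed.inter ?_ (IsClosed.inter ?_ (IsClosed.inter ?_
      (IsClosed.inter ?_ (IsClosed.inter ?_ ?_)))))
    · exact isClosed_le (by fun_prop) (by fun_prop)
    · exact isClosed_iInter fun j => isClosed_le (by fun_prop) (by fun_prop)
    · exact isClosed_le (by fun_prop) (by fun_prop)
    · exact isClosed_iInter fun j => isClosed_le (by fun_prop) (by fun_prop)
    · exact isClosed_iInter fun j => isClosed_le (by fun_prop) (by fun_prop)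
    · exact isClosed_le (by fun_prop) (by fun_prop)
    · exact isClosed_iInter fun j => isClosed_le (by fun_prop) (by fun_prop)
  refine IsSeqClosed.isClosed fun x ρ hx hlim => ?_
  have hx' : ∀ k, ∃ y : ℝ × (Fin h → ℝ), (x k, y) ∈ T := by
    intro k
    obtain ⟨h1, h2, r, r', h3, h4, h5, h6, h7⟩ := hx k
    exact ⟨(r, r'), h1, h2, h3, h4, h5, h6, h7⟩
  choose y hy using hx'
  obtain ⟨B, hB⟩ := (Metric.isBounded_range_of_tendsto x hlim).exists_norm_le
  have hyB : ∀ k, y k ∈ Metric.closedBall (0 : ℝ × (Fin h → ℝ)) B := by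
    intro k
    rw [mem_closedBall_zero_iff]
    refine le_trans ?_ (hB (x k) ⟨k, rfl⟩)
    obtain ⟨h1, h2, h3, h4, h5, h6, h7⟩ := hy k
    simp only at h1 h2 h3 h4 h5 h6 h7
    refine norm_prod_le_iff.2 ⟨?_, ?_⟩
    · refine le_trans ?_ (norm_fst_le (x k))
      rw [Real.norm_of_nonneg h3, Real.norm_of_nonneg h1]
      have h8 := h5 ⟨0, ht⟩
      have h9 : 0 ≤ ∑ j with j ∉ V ⟨0, ht⟩, (y k).2 j := Finset.sum_nonneg fun j _ => h4 j
      linarith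
    · refine le_trans ?_ (norm_snd_le (x k))
      refine (pi_norm_le_iff_of_nonneg (norm_nonneg _)).2 fun j => ?_
      refine le_trans ?_ (norm_le_pi_norm _ j)
      rw [Real.norm_of_nonneg (h4 j), Real.norm_of_nonneg (h2 j)]
      exact h7 j
  obtain ⟨z, -, ψ, hψ, hz⟩ := tendsto_subseq_of_bounded Metric.isBounded_closedBall hyB
  obtain ⟨h1, h2, h3, h4, h5, h6, h7⟩ := hTc.mem_of_tendsto
    ((hlim.comp hψ.tendsto_atTop).prodMk_nhds hz) (Eventually.of_forall fun k => hy (ψ k))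
  exact ⟨h1, h2, z.1, z.2, h3, h4, h5, h6, h7⟩

lemma tendsto_add_one_div (R : ℝ) (S : Fin h → ℝ) :
    Tendsto (fun k : ℕ => (R + 1 / ((k : ℝ) + 1), S)) atTop (𝓝 (R, S)) := by
  refine Tendsto.prodMk_nhds ?_ tendsto_const_nhds
  simpa using (tendsto_one_div_add_atTop_nhds_zero_nat (𝕜 := ℝ)).const_add R

end Region

end Omniscient

/-! ### The two inclusions and the theorem -/

namespace Omniscient

section Main

variable {t h : ℕ} {V : Fin t → Finset (Fin h)} {𝒳 : Type*} [Fintype 𝒳]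

lemma entropy_eq (qX : PMF 𝒳) :
    entropy qX * Real.log 2 = ∑ a, Real.negMulLog (qX a).toReal := by
  rw [entropy, ← Finset.sum_div, div_mul_cancel₀ _ (Real.log_pos one_lt_two).ne']

lemma _root_.PMF.nonempty {α : Type*} (p : PMF α) : Nonempty α :=
  ⟨p.support_nonempty.choose⟩

/-- Adding slack to the message rate of a tuple in the linear region makes it achievable. -/
lemma achievable_of_mem_linearRegion (i₀ : Fin t) (qX : PMF 𝒳) {ρ : ℝ × (Fin h → ℝ)}
    (hρ : ρ ∈ linearRegion V (entropy qX)) {δ : ℝ} (hδ : 0 < δ) :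
    Achievable (𝒳 := fun _ => 𝒳) V (qX.map fun x => fun _ : Fin t => x) (ρ.1 + 2 * δ, ρ.2) := by
  classical
  obtain ⟨hR, hRj, r, r', hr, hr', hV, hH, hle⟩ := hρ
  have := qX.nonempty
  have hlog := Real.log_pos one_lt_two
  have hR2 : 0 ≤ ρ.1 + 2 * δ := by linarith
  have hrδ : 0 ≤ r + δ := by linarith
  refine ⟨hR2, hRj, ?_⟩
  set N : ℕ → ℕ := fun n => indexSize n (ρ.1 + 2 * δ) with hN
  -- One `δ` pushes the atoms below `2^{-nH}`; the other, in `N`, absorbs the factor `t` and the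
  -- rounding in the colour count.
  set N₀ : ℕ → ℕ := fun n => indexSize n (r + δ) with hN₀
  set K : ℕ → Fin h → ℕ := fun n j => indexSize n (ρ.2 j) with hK
  set K' : ℕ → Fin h → ℕ := fun n j => indexSize n (r' j) with hK'
  set Q : ∀ n, (Fin n → 𝒳) → ℝ := fun n a => ∏ s, (qX (a s)).toReal with hQ
  have hQ0 : ∀ n a, 0 ≤ Q n a := fun n a => Finset.prod_nonneg fun s _ => ENNReal.toReal_nonneg
  have hQ1 : ∀ n, ∑ a, Q n a = 1 := fun n => by
    simp only [hQ]
    rw [sum_prod_eq_pow fun a => (qX a).toReal, sum_toReal_eq_one, one_pow]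
  -- Rounding of `N₀` costs `2`; each source costs `2` for rounding and `2` for its uneven residues.
  set C : ℝ := 2 * 4 ^ h with hC
  set ε : ℕ → ℝ := fun n =>
    C * Real.exp (-(n * (∑ a, Real.negMulLog (qX a).toReal + δ * Real.log 2))) with hε
  have hatom : ∀ n, (N₀ n : ℝ)⁻¹ * ∏ j, (2 / (K' n j : ℝ)) ≤ ε n := by
    intro n
    have h1 : (N₀ n : ℝ)⁻¹ ≤ 2 * (2 : ℝ) ^ (-((n : ℝ) * (r + δ))) := by
      have h2 := two_rpow_le_two_mul_indexSize n hrδ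
      have h3 : (0 : ℝ) < N₀ n := by exact_mod_cast indexSize_pos n hrδ
      rw [Real.rpow_neg two_pos.le, inv_le_comm₀ h3 (by positivity), mul_inv, inv_inv,
        inv_mul_le_iff₀ two_pos]
      exact h2
    have h4 : ∀ j, 2 / (K' n j : ℝ) ≤ 4 * (2 : ℝ) ^ (-((n : ℝ) * r' j)) := by
      intro j
      have h2 := two_rpow_le_two_mul_indexSize n (hr' j)
      have h3 : (0 : ℝ) < K' n j := by exact_mod_cast indexSize_pos n (hr' j)
      rw [Real.rpow_neg two_pos.le, div_le_iff₀ h3, mul_assoc, mul_comm _⁻¹,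
        ← div_eq_mul_inv, ← mul_div_assoc, le_div_iff₀ (by positivity)]
      linarith
    calc (N₀ n : ℝ)⁻¹ * ∏ j, (2 / (K' n j : ℝ))
        ≤ (2 * (2 : ℝ) ^ (-((n : ℝ) * (r + δ)))) *
            ∏ j, (4 * (2 : ℝ) ^ (-((n : ℝ) * r' j))) :=
          mul_le_mul h1 (Finset.prod_le_prod (fun j _ => by positivity) fun j _ => h4 j)
            (Finset.prod_nonneg fun j _ => by positivity) (by positivity)
      _ = C * (2 : ℝ) ^ (-((n : ℝ) * (r + δ + ∑ j, r' j))) := by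
          have h5 : -((n : ℝ) * (r + δ + ∑ j, r' j)) =
              -((n : ℝ) * (r + δ)) + ∑ j, -((n : ℝ) * r' j) := by
            rw [Finset.sum_neg_distrib, ← Finset.mul_sum]
            ring
          rw [Finset.prod_mul_distrib, Finset.prod_const, Finset.card_univ, Fintype.card_fin,
            ← Real.rpow_sum_of_pos two_pos, hC, h5, Real.rpow_add two_pos]
          ring
      _ ≤ ε n := by
          rw [Real.rpow_def_of_pos two_pos]
          refine mul_le_mul_of_nonneg_left (Real.exp_le_exp.2 ?_) (by positivity)
          rw [← entropy_eq qX]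
          have h5 : (0 : ℝ) ≤ n * Real.log 2 := by positivity
          have h6 := mul_le_mul_of_nonneg_left hH h5
          nlinarith
  have hcount : ∀ᶠ n : ℕ in atTop, ∑ i, N₀ n * ∏ j with j ∉ V i, K' n j < N n := by
    have h1 : Tendsto (fun n : ℕ => ((2 : ℝ) ^ δ) ^ n) atTop atTop :=
      tendsto_pow_atTop_atTop_of_one_lt (Real.one_lt_rpow one_lt_two hδ)
    filter_upwards [h1.eventually_gt_atTop (2 * (t : ℝ))] with n hn
    have h2 : ∀ i, ((N₀ n * ∏ j with j ∉ V i, K' n j : ℕ) : ℝ) ≤ 2 ^ ((n : ℝ) * (ρ.1 + δ)) := by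
      intro i
      push_cast
      calc (N₀ n : ℝ) * ∏ j with j ∉ V i, (K' n j : ℝ)
          ≤ 2 ^ ((n : ℝ) * (r + δ)) * ∏ j with j ∉ V i, (2 : ℝ) ^ ((n : ℝ) * r' j) :=
            mul_le_mul (indexSize_le n _)
              (Finset.prod_le_prod (fun j _ => by positivity) fun j _ => indexSize_le n _)
              (Finset.prod_nonneg fun j _ => by positivity) (by positivity)
        _ = 2 ^ ((n : ℝ) * (r + δ + ∑ j with j ∉ V i, r' j)) := by
            rw [← Real.rpow_sum_of_pos two_pos, ← Finset.mul_sum, ← Real.rpow_add two_pos,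
              ← mul_add]
        _ ≤ 2 ^ ((n : ℝ) * (ρ.1 + δ)) := by
            refine Real.rpow_le_rpow_of_exponent_le one_le_two
              (mul_le_mul_of_nonneg_left ?_ (by positivity))
            linarith [hV i]
    have h3 : ((∑ i, N₀ n * ∏ j with j ∉ V i, K' n j : ℕ) : ℝ) ≤
        t * 2 ^ ((n : ℝ) * (ρ.1 + δ)) := by
      rw [Nat.cast_sum]
      refine (Finset.sum_le_sum fun i _ => h2 i).trans (le_of_eq ?_)
      simp
    have h4 : (2 : ℝ) ^ ((n : ℝ) * (ρ.1 + 2 * δ)) =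
        ((2 : ℝ) ^ δ) ^ n * 2 ^ ((n : ℝ) * (ρ.1 + δ)) := by
      rw [← Real.rpow_natCast, ← Real.rpow_mul two_pos.le, ← Real.rpow_add two_pos]
      ring_nf
    have h5 := two_rpow_le_two_mul_indexSize n hR2
    have h6 : (0 : ℝ) < 2 ^ ((n : ℝ) * (ρ.1 + δ)) := by positivity
    have h7 := mul_lt_mul_of_pos_right hn h6
    rw [h4] at h5
    have h8 : ((∑ i, N₀ n * ∏ j with j ∉ V i, K' n j : ℕ) : ℝ) < (N n : ℝ) := by
      simp only [hN]
      linarith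
    exact_mod_cast h8
  have hcode : ∀ n, ∃ c : SimulationCode V (fun _ => 𝒳) n (N n) (K n),
      ∑ i, N₀ n * ∏ j with j ∉ V i, K' n j < N n →
      ∑ x : Fin t → Fin n → 𝒳, |c.induced x - if ∀ i, x i = x i₀ then Q n (x i₀) else 0| ≤
        2 * ∑ a, min (Q n a) (ε n) := by
    intro n
    by_cases hn : ∑ i, N₀ n * ∏ j with j ∉ V i, K' n j < N n
    · obtain ⟨c, hc⟩ := exists_code (K := K n) V i₀ (indexSize_pos n hrδ)
        (fun j => indexSize_pos n (hr' j)) (fun j => indexSize_mono n (hle j)) hn (Q n) (hQ0 n)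
        (hQ1 n)
      refine ⟨c, fun _ => le_trans (le_of_eq ?_) (hc.trans ?_)⟩
      · congr!
      · gcongr
        exact hatom n
    -- Only finitely many block lengths are affected, so any code will do.
    · exact ⟨⟨fun _ => PMF.pure ⟨0, indexSize_pos n hR2⟩,
        fun _ _ _ => PMF.pure (Classical.arbitrary _)⟩, fun hh => absurd hh hn⟩
  choose c hc using hcode
  refine ⟨c, ?_⟩
  have hlim := (tendsto_sum_min_prod (fun a => (qX a).toReal) (fun a => ENNReal.toReal_nonneg)
    (sum_toReal_eq_one qX) (C := C) (mul_pos hδ hlog) (by positivity)).const_mul 2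
  rw [mul_zero] at hlim
  refine squeeze_zero' (Eventually.of_forall fun n => Finset.sum_nonneg fun x _ => abs_nonneg _)
    ?_ hlim
  filter_upwards [hcount] with n hn
  refine le_trans (le_of_eq ?_) (hc n hn)
  refine Finset.sum_congr rfl fun x _ => ?_
  rw [iid_map_diagonal qX n i₀]

/-- Every achievable rate tuple lies in the linear region, up to slack in the message rate. -/
lemma mem_linearRegion_of_achievable (ht : 2 ≤ t) (qX : PMF 𝒳) {ρ : ℝ × (Fin h → ℝ)}
    (hρ : Achievable (𝒳 := fun _ => 𝒳) V (qX.map fun x => fun _ : Fin t => x) ρ)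
    {ε : ℝ} (hε : 0 < ε) :
    (ρ.1 + 2 * ε, ρ.2) ∈ linearRegion V (entropy qX) := by
  classical
  obtain ⟨hR, hRj, c, hc⟩ := hρ
  have := qX.nonempty
  have hlog := Real.log_pos one_lt_two
  set i₀ : Fin t := ⟨0, by omega⟩ with hi₀
  set L := Real.log (Fintype.card 𝒳) with hL
  have hL0 : 0 ≤ L := Real.log_natCast_nonneg _
  set q := qX.map fun x => fun _ : Fin t => x with hq
  set d : ℕ → ℝ := fun n =>
    ∑ x : Fin t → Fin n → 𝒳, |(c n).induced x - iid (𝒳 := fun _ => 𝒳) q n x| with hd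
  -- The sum, per letter, of the errors in `hmsg` and `hent`. One block long enough to bring it
  -- below `ε * log 2` suffices.
  have hlim : Tendsto (fun n : ℕ => (Real.log 2 + 1) / (n : ℝ) +
      d n * ((2 * Real.log 2 + 1) / (n : ℝ)) + 3 * L * d n) atTop (𝓝 0) := by
    have h1 := tendsto_const_div_atTop_nhds_zero_nat (Real.log 2 + 1)
    have h2 := tendsto_const_div_atTop_nhds_zero_nat (2 * Real.log 2 + 1)
    simpa using (h1.add (hc.mul h2)).add (hc.const_mul (3 * L))
  obtain ⟨n, hn, hn0⟩ := ((hlim.eventually (gt_mem_nhds (mul_pos hε hlog))).and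
    (eventually_gt_atTop 0)).exists
  have hnR : (0 : ℝ) < n := by exact_mod_cast hn0
  have hd0 : 0 ≤ d n := Finset.sum_nonneg fun x _ => abs_nonneg _
  have hbudget : (Real.log 2 + 1) + d n * (2 * Real.log 2 + 1) + 3 * L * d n * n ≤
      ε * Real.log 2 * n := by
    have h1 := mul_le_mul_of_nonneg_right hn.le hnR.le
    refine le_trans (le_of_eq ?_) h1
    field_simp
  have hKpos : ∀ j, 0 < indexSize n (ρ.2 j) := fun j => indexSize_pos n (hRj j)
  have hδ : ∀ i k, ∑ ω, (c n).mass ω * (if ω.2.2 i = ω.2.2 k then 0 else 1) ≤ d n := by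
    intro i k
    rw [(c n).sum_induced fun x => if x i = x k then 0 else 1]
    refine Finset.sum_le_sum fun x _ => ?_
    rw [iid_map_diagonal qX n i₀]
    by_cases hx : x i = x k
    · simp [hx]
    · rw [if_neg hx, mul_one, if_neg fun hh => hx ((hh i).trans (hh k).symm), sub_zero]
      exact le_abs_self _
  obtain ⟨r, r', hr, hr', hr'K, hV, hsum⟩ := (c n).exists_rates ht hKpos (δ := d n)
    (fun i k => le_trans (le_of_eq (by congr!)) (hδ i k)) i₀
  set Q : (Fin n → 𝒳) → ℝ := fun a => ∏ s, (qX (a s)).toReal with hQ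
  set p : (Fin n → 𝒳) → ℝ := fun a => ∑ x, (c n).induced x * if x i₀ = a then 1 else 0 with hp
  have hsum' : r + ∑ j, r' j = ∑ a, Real.negMulLog (p a) := by
    rw [hsum]
  have hp0 : ∀ a, 0 ≤ p a := fun a => Finset.sum_nonneg fun x _ =>
    mul_nonneg ((c n).induced_nonneg x) (by split_ifs <;> simp)
  have hind1 : ∑ x, (c n).induced x = 1 := by
    have := (c n).sum_induced fun _ => 1
    simp only [mul_one] at this
    rw [← this, (c n).sum_mass hKpos]
  have hp1 : ∀ a, p a ≤ 1 := fun a => by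
    rw [← hind1]
    refine Finset.sum_le_sum fun x _ => mul_le_of_le_one_right ((c n).induced_nonneg x) ?_
    split_ifs <;> simp
  have hQsum : ∀ a, Q a =
      ∑ x : Fin t → Fin n → 𝒳, iid (𝒳 := fun _ => 𝒳) q n x * if x i₀ = a then 1 else 0 := by
    intro a
    rw [Finset.sum_eq_single fun _ => a]
    · simp [hq, iid_map_diagonal qX n i₀, hQ]
    · intro x _ hx
      rw [iid_map_diagonal qX n i₀]
      by_cases hd : ∀ i, x i = x i₀
      · rw [if_neg (c := x i₀ = a) fun hh => hx (funext fun i => (hd i).trans hh), mul_zero]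
      · rw [if_neg hd, zero_mul]
    · simp
  have hpQ : ∑ a, |p a - Q a| ≤ d n := by
    calc ∑ a, |p a - Q a| ≤ ∑ a, ∑ x : Fin t → Fin n → 𝒳,
          |(c n).induced x - iid (𝒳 := fun _ => 𝒳) q n x| * (if x i₀ = a then 1 else 0) := by
          refine Finset.sum_le_sum fun a _ => ?_
          rw [hQsum a, hp, ← Finset.sum_sub_distrib]
          refine (Finset.abs_sum_le_sum_abs _ _).trans (Finset.sum_le_sum fun x _ => ?_)
          split_ifs <;> simp
      _ = d n := by
          rw [Finset.sum_comm]
          refine Finset.sum_congr rfl fun x _ => ?_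
          simp
  have hcardA : Real.log (Fintype.card (Fin n → 𝒳)) = n * L := by
    rw [Fintype.card_fun, Fintype.card_fin, Nat.cast_pow, Real.log_pow]
  have hent : n * (entropy qX * Real.log 2) ≤ r + ∑ j, r' j + d n * (1 + n * L) + 1 := by
    have h1 := sum_negMulLog_le p Q hp0 hp1 fun a =>
      Finset.prod_nonneg fun s _ => ENNReal.toReal_nonneg
    simp only [hQ] at h1
    rw [sum_negMulLog_prod (fun a => (qX a).toReal) (sum_toReal_eq_one qX), ← entropy_eq,
      hcardA, ← hsum'] at h1
    have h2 : (∑ a, |p a - Q a|) * (1 + n * L) ≤ d n * (1 + n * L) :=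
      mul_le_mul_of_nonneg_right hpQ (by positivity)
    linarith
  have hmsg : ∀ i, (∑ j with j ∉ V i, r' j) + r ≤
      n * ρ.1 * Real.log 2 + Real.log 2 + 2 * d n * (Real.log 2 + n * L) := by
    intro i
    have h1 := hV i
    have h2 : (indexSize n ρ.1 : ℝ) ≠ 0 := by exact_mod_cast (indexSize_pos n hR).ne'
    have h3 : (Fintype.card (Fin n → 𝒳) : ℝ) ≠ 0 := by exact_mod_cast Fintype.card_ne_zero
    rw [Real.log_mul two_ne_zero h2, Real.log_mul two_ne_zero h3, hcardA] at h1
    linarith [log_indexSize_le n hR]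
  have hnl : 0 < n * Real.log 2 := mul_pos hnR hlog
  have e1 : 0 ≤ d n * Real.log 2 := by positivity
  have e2 : 0 ≤ d n * L * n := by positivity
  -- The `ε` added to `r` makes up for the entropy deficit; with the `ε` lost in the message bound,
  -- this explains the slack `2 * ε`.
  refine ⟨by simp only; linarith, hRj, r / (n * Real.log 2) + ε, fun j => r' j / (n * Real.log 2),
    by positivity, fun j => div_nonneg (hr' j) hnl.le, fun i => ?_, ?_, fun j => ?_⟩
  · have h1 : ((∑ j with j ∉ V i, r' j) + r) / (n * Real.log 2) ≤ ρ.1 + ε := by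
      rw [div_le_iff₀ hnl]
      linarith [hmsg i]
    rw [← Finset.sum_div]
    rw [add_div] at h1
    simp only
    linarith
  · have h1 : entropy qX - ε ≤ (r + ∑ j, r' j) / (n * Real.log 2) := by
      rw [le_div_iff₀ hnl]
      linarith
    rw [← Finset.sum_div]
    rw [add_div] at h1
    linarith
  · rw [div_le_iff₀ hnl]
    linarith [hr'K j, log_indexSize_le n (hRj j)]

end Main

end Omniscient

theorem mainTheorem6 {t h : ℕ} (ht : 2 ≤ t) (V : Fin t → Finset (Fin h))
    {𝒳 : Type*} [Fintype 𝒳] (q : PMF (Fin t → 𝒳)) (qX : PMF 𝒳)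
    (hq : q = qX.map (fun x => fun _ : Fin t => x)) :
    Omniscient.rateRegion V (𝒳 := fun _ => 𝒳) q =
      {ρ : ℝ × (Fin h → ℝ) | 0 ≤ ρ.1 ∧ (∀ j, 0 ≤ ρ.2 j) ∧
        ∃ (r : ℝ) (r' : Fin h → ℝ), 0 ≤ r ∧ (∀ j, 0 ≤ r' j) ∧
          (∀ i, (∑ j with j ∉ V i, r' j) + r ≤ ρ.1) ∧
          Omniscient.entropy qX ≤ r + ∑ j, r' j ∧
          ∀ j, r' j ≤ ρ.2 j} := by
  subst hq
  change _ = Omniscient.linearRegion V (Omniscient.entropy qX)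
  have hslack : ∀ k : ℕ, 2 * ((1 : ℝ) / ((k : ℝ) + 1) / 2) = 1 / ((k : ℝ) + 1) := fun k =>
    mul_div_cancel₀ _ two_ne_zero
  have hclosed := Omniscient.isClosed_linearRegion (by omega) V (Omniscient.entropy qX)
  refine Set.Subset.antisymm (closure_minimal (fun ρ hρ => ?_) hclosed) fun ρ hρ => ?_
  · refine hclosed.mem_of_tendsto (Omniscient.tendsto_add_one_div ρ.1 ρ.2)
      (Eventually.of_forall fun k => ?_)
    have := Omniscient.mem_linearRegion_of_achievable ht qX hρ
      (by positivity : (0 : ℝ) < 1 / ((k : ℝ) + 1) / 2)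
    rwa [hslack] at this
  · refine mem_closure_of_tendsto (Omniscient.tendsto_add_one_div ρ.1 ρ.2)
      (Eventually.of_forall fun k => ?_)
    have := Omniscient.achievable_of_mem_linearRegion ⟨0, by omega⟩ qX hρ
      (by positivity : (0 : ℝ) < 1 / ((k : ℝ) + 1) / 2)
    rwa [hslack] at this
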